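/- Let $\nu\in\{1,-1\}$ and $\gamma>0$, and let $\mathcal{L}=\nu I+\gamma\mathcal{B}$, where $\mathcal{B}$ is the operator on $L^2(\mathbb{R}^2)$ with $\widehat{\mathcal{B}f}(\xi)=\frac{\xi_1^2}{\xi_1^2+\xi_2^2}\hat f(\xi)$. Let $C_{opt}$ denote the optimal (smallest) constant $C$ in the inequality $$\int_{\mathbb{R}^2}\mathcal{L}(|u|^2)\,|u|^2\,dx\le C\,\|\nabla u\|_2^2\,\|u\|_2^2\qquad\text{for all complex-valued }u\in H^1(\mathbb{R}^2).$$ Let $0<m,M<\infty$ and let $\{v_n\}_{n=1}^\infty$ be a bounded sequence in $H^1(\mathbb{R}^2)$ such that $$\limsup_{n\to\infty}\|\nabla v_n\|_2^2\le M^2,\qquad \limsup_{n\to\infty}\int_{\mathbb{R}^2}\mathcal{L}(|v_n|^2)\,|v_n|^2\,dx\ge m^4 .$$ Then the optimal constant $C_{opt}$ exists and is positive, and there are a sequence $\{x_n\}\subset\mathbb{R}^2$ and a function $V\in H^1(\mathbb{R}^2)$ such that, along a subsequence, $v_n(\cdot+x_n)\rightharpoonup V$ weakly in $H^1(\mathbb{R}^2)$,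 and $$\|V\|_2\ge\frac{m^2}{M\sqrt{C_{opt}}}.$$ -/

import Mathlib

open MeasureTheory Filter Topology FourierTransform LineDeriv
open scoped ENNReal SchwartzMap

noncomputable section

namespace DaveyStewartson

/-- The plane `ℝ²` with its Euclidean norm. -/
abbrev Plane : Type := EuclideanSpace ℝ (Fin 2)

/-- The Hilbert space `L²(ℝ²; ℂ)`. -/
abbrev L2 : Type := Lp ℂ 2 (volume : Measure Plane)

/-- Pairs `(u, g)` of an `L²` function and an `L²` vector field `g = (g₀, g₁)`, with the Hilbert
norm `(‖u‖₂² + ‖g₀‖₂² + ‖g₁‖₂²)^{1/2}`. -/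
abbrev Pairs : Type := WithLp 2 (L2 × PiLp 2 (fun _ : Fin 2 => L2))

/-- `g` is the weak (distributional) derivative of `u` in the `i`-th coordinate direction. -/
def IsWeakPartial (i : Fin 2) (u g : L2) : Prop :=
  ∂_{(EuclideanSpace.single i (1 : ℝ) : Plane)} (u : 𝓢'(Plane, ℂ)) = (g : 𝓢'(Plane, ℂ))

/-- Unfolded: `∫ φ g = - ∫ (∂ᵢ φ) u` for all test functions `φ`. -/
theorem isWeakPartial_iff (i : Fin 2) (u g : L2) :
    IsWeakPartial i u g ↔ ∀ φ : 𝓢(Plane, ℂ),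
      ∫ x, φ x • g x
        = -∫ x, (∂_{(EuclideanSpace.single i (1 : ℝ) : Plane)} φ : 𝓢(Plane, ℂ)) x • u x := by
  unfold IsWeakPartial
  constructor
  · intro h φ
    have h1 := congrArg (fun T : 𝓢'(Plane, ℂ) => T φ) h
    simp only [TemperedDistribution.lineDerivOp_apply_apply,
      Lp.toTemperedDistribution_apply] at h1
    rw [← h1, ← integral_neg]
    congr 1
    ext x
    simp
  · intro h
    ext φ
    simp only [TemperedDistribution.lineDerivOp_apply_apply, Lp.toTemperedDistribution_apply]
    rw [h φ, ← integral_neg]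
    congr 1
    ext x
    simp

/-- The subspace of those pairs `(u, g)` in which `g` is the weak gradient of `u`. -/
def sobolevSubmodule : Submodule ℂ Pairs where
  carrier := {p | ∀ i, IsWeakPartial i p.fst (p.snd i)}
  zero_mem' := by
    intro i
    unfold IsWeakPartial
    simp only [← Lp.toTemperedDistributionCLM_apply]
    simp only [WithLp.zero_fst, WithLp.zero_snd, PiLp.zero_apply, map_zero, lineDerivOp_zero]
  add_mem' := by
    intro p q hp hq i
    have h1 := hp i
    have h2 := hq i
    unfold IsWeakPartial at h1 h2 ⊢
    simp only [← Lp.toTemperedDistributionCLM_apply] at h1 h2 ⊢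
    simp only [WithLp.add_fst, WithLp.add_snd, PiLp.add_apply, map_add, lineDerivOp_add, h1, h2]
  smul_mem' := by
    intro c p hp i
    have h1 := hp i
    unfold IsWeakPartial at h1 ⊢
    simp only [← Lp.toTemperedDistributionCLM_apply] at h1 ⊢
    simp only [WithLp.smul_fst, WithLp.smul_snd, PiLp.smul_apply, map_smul, lineDerivOp_smul, h1]

/-- The Sobolev space `H¹(ℝ²; ℂ)`: a function `u ∈ L²` together with its weak gradient `g ∈ L²`
(which is determined by `u`). The inherited norm is `(‖u‖₂² + ‖∇u‖₂²)^{1/2}`. -/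
abbrev H1 : Type := sobolevSubmodule

/-- The underlying `L²` function of an element of `H¹`. -/
def toL2 (u : H1) : L2 := (u : Pairs).fst

/-- The weak gradient of an element of `H¹`. -/
def grad (u : H1) : PiLp 2 (fun _ : Fin 2 => L2) := (u : Pairs).snd

/-- The translate `f(· + a)` of `f ∈ L²`. -/
def shift (a : Plane) (f : L2) : L2 :=
  Lp.compMeasurePreserving (fun x => x + a) (measurePreserving_add_right volume a) f

theorem coeFn_shift (a : Plane) (f : L2) : shift a f =ᵐ[volume] fun x => f (x + a) :=
  Lp.coeFn_compMeasurePreserving f (measurePreserving_add_right volume a)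

theorem integral_smul_shift (a : Plane) (f : L2) (φ : Plane → ℂ) :
    ∫ x, φ x • shift a f x = ∫ x, φ (x - a) • f x := by
  rw [← integral_add_right_eq_self (fun x => φ (x - a) • f x) a]
  apply integral_congr_ae
  filter_upwards [coeFn_shift a f] with x hx
  simp [hx]

theorem IsWeakPartial.shift {i : Fin 2} {u g : L2} (h : IsWeakPartial i u g) (a : Plane) :
    IsWeakPartial i (shift a u) (shift a g) := by
  rw [isWeakPartial_iff] at h ⊢
  intro φ
  rw [integral_smul_shift, integral_smul_shift]
  have h1 := h (φ.compSubConstCLM ℂ a)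
  simp only [SchwartzMap.compSubConstCLM_apply] at h1
  rw [h1]
  congr 2
  ext x
  congr 1
  simp only [SchwartzMap.lineDerivOp_apply_eq_fderiv]
  have : (⇑(φ.compSubConstCLM ℂ a) : Plane → ℂ) = fun y => φ (y - a) := rfl
  rw [this, fderiv_comp_sub]

/-- The translate `u(· + a)` of `u ∈ H¹`. -/
def translate (a : Plane) (u : H1) : H1 :=
  ⟨WithLp.toLp 2 (shift a (toL2 u), WithLp.toLp 2 fun i => shift a (grad u i)),
    fun i => (u.2 i).shift a⟩

/-- The symbol `ξ₁² / (ξ₁² + ξ₂²)`. It is homogeneous of degree zero, so that it does not depend on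
the normalization of the Fourier transform; its value at the origin is irrelevant. -/
def symbolB (ξ : Plane) : ℂ := ((ξ 0 ^ 2 / (ξ 0 ^ 2 + ξ 1 ^ 2) : ℝ) : ℂ)

theorem memLp_symbolB : MemLp symbolB ∞ (volume : Measure Plane) := by
  apply memLp_top_of_bound (C := 1)
  · have : Measurable symbolB := by unfold symbolB; fun_prop
    exact this.aestronglyMeasurable
  · refine Eventually.of_forall fun ξ => ?_
    unfold symbolB
    rw [Complex.norm_real, Real.norm_eq_abs, abs_of_nonneg (by positivity)]
    exact div_le_one_of_le₀ (by nlinarith [sq_nonneg (ξ 1)]) (by positivity)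

/-- The operator `𝓑` on `L²`, `(𝓑 f)^(ξ) = ξ₁² / (ξ₁² + ξ₂²) f^(ξ)`. -/
def opB (f : L2) : L2 :=
  𝓕⁻ ((memLp_symbolB.toLp symbolB • (𝓕 f : L2) : L2))

/-- The operator `𝓛 = ν I + γ 𝓑` on `L²`. -/
def opL (ν γ : ℝ) (f : L2) : L2 := (ν : ℂ) • f + (γ : ℂ) • opB f

open Classical in
/-- The function `|u|²` as an element of `L²`. For `u ∈ H¹(ℝ²)` one has `u ∈ L⁴` by the Sobolev
embedding, so that the first case always applies to such `u`. -/
def normSq (u : L2) : L2 :=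
  if h : MemLp (fun x => ((‖u x‖ ^ 2 : ℝ) : ℂ)) 2 (volume : Measure Plane) then h.toLp _ else 0

/-- The quantity `∫ 𝓛(|u|²) |u|² dx`. The symbol of `𝓛` is real and even, so that `𝓛(|u|²)` is
real-valued and taking the real part only changes the type. -/
def quartic (ν γ : ℝ) (u : H1) : ℝ :=
  (∫ x, opL ν γ (normSq (toL2 u)) x * normSq (toL2 u) x).re

/-- The constants `C` with `∫ 𝓛(|u|²) |u|² dx ≤ C ‖∇u‖₂² ‖u‖₂²` for all `u ∈ H¹(ℝ²)`. -/
def admissibleConstants (ν γ : ℝ) : Set ℝ :=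
  {C | ∀ u : H1, quartic ν γ u ≤ C * ‖grad u‖ ^ 2 * ‖toL2 u‖ ^ 2}

/-- The optimal constant in `∫ 𝓛(|u|²) |u|² dx ≤ C ‖∇u‖₂² ‖u‖₂²`. -/
def Copt (ν γ : ℝ) : ℝ := sInf (admissibleConstants ν γ)

/-- Weak convergence in the Hilbert space `H¹(ℝ²)`. -/
def WeaklyConverges (w : ℕ → H1) (V : H1) : Prop :=
  ∀ ℓ : H1 →L[ℂ] ℂ, Tendsto (fun k => ℓ (w k)) atTop (𝓝 (ℓ V))

end DaveyStewartson

end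

noncomputable section

namespace DaveyStewartson

/-! The proof is concentration compactness, removing one weak limit at a time. Write Q for the
quartic functional. Suppose translates of a bounded sequence converge weakly to V. Then the limits
of ‖·‖₂², ‖∇·‖₂² and Q along the remainder are those of the sequence minus the values at V
(`WeaklyConverges.tendsto_sub`, resting on the Brezis–Lieb property
`WeaklyConverges.tendsto_quartic_sub`). Up to translation, every weak limit of the remainder is 0 or
already a weak limit of the original sequence (`IsTranslatedLimit.of_sub`).

As long as Q ≥ ε, a limit with ‖V‖₂² ≥ δ can be extracted, with δ independent of the sequence
(`exists_translate_weaklyConverges`). Each removal therefore costs mass at least δ, so after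
finitely many removals the limit of Q is at most ε. If every translated limit W has ‖W‖₂² ≤ A,
removing V lowers Q by at most C A ‖∇V‖₂², and the gradient terms sum to at most g = lim ‖∇v_n‖₂².
Hence lim Q ≤ C A g (`quartic_limit_le`).

Take C = C_opt and A = m⁴ / (M² C_opt). If all translated limits were strictly below A, one nonzero
limit would make this bound strict, giving m⁴ ≤ lim Q < C A M² = m⁴.

The analytic inputs are the Gagliardo–Nirenberg inequality, obtained from the L¹ Sobolev inequality
for u², and local compactness, obtained from a sharp low-frequency projection. -/

/-! ### `L²` preliminaries and Fourier multipliers -/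

/-- Locally integrable functions that agree as tempered distributions agree almost everywhere. -/
theorem ae_eq_of_integral_schwartz_smul_eq {f g : Plane → ℂ} (hf : LocallyIntegrable f)
    (hg : LocallyIntegrable g) (h : ∀ φ : 𝓢(Plane, ℂ), ∫ x, φ x • f x = ∫ x, φ x • g x) :
    f =ᵐ[volume] g := by
  apply ae_eq_of_integral_contDiff_smul_eq hf hg
  intro k hk hk'
  have h1 : ContDiff ℝ (⊤ : ℕ∞) fun x => (k x : ℂ) := Complex.ofRealCLM.contDiff.comp hk
  have h2 : HasCompactSupport fun x => (k x : ℂ) := hk'.comp_left Complex.ofReal_zero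
  simpa using h (h2.toSchwartzMap h1)

theorem locallyIntegrable_coe (f : L2) : LocallyIntegrable f (volume : Measure Plane) :=
  (Lp.memLp f).locallyIntegrable (by norm_num)

theorem norm_sq_eq_integral (f : L2) : ‖f‖ ^ 2 = ∫ x, ‖f x‖ ^ 2 := by
  have h := L2.inner_def (𝕜 := ℂ) f f
  rw [inner_self_eq_norm_sq_to_K] at h
  have h2 : ∀ x, inner ℂ (f x) (f x) = ((‖f x‖ ^ 2 : ℝ) : ℂ) := fun x => by
    rw [inner_self_eq_norm_sq_to_K]; push_cast; rfl
  simp_rw [h2] at h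
  rw [integral_complex_ofReal] at h
  exact Complex.ofReal_injective (by simpa using h)

theorem integrable_norm_sq (f : L2) : Integrable (fun x => ‖f x‖ ^ 2) (volume : Measure Plane) :=
  (Lp.memLp f).integrable_norm_pow (by norm_num)

/-- The triangle inequality, for a pointwise bound by two `L²` functions. -/
theorem norm_le_add_of_ae_le {f g h : L2} {a b : ℝ} (ha : 0 ≤ a) (hb : 0 ≤ b)
    (H : ∀ᵐ x, ‖f x‖ ≤ a * ‖g x‖ + b * ‖h x‖) : ‖f‖ ≤ a * ‖g‖ + b * ‖h‖ := by
  have hg : MemLp (fun x => a * ‖g x‖) 2 (volume : Measure Plane) := (Lp.memLp g).norm.const_mul a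
  have hh : MemLp (fun x => b * ‖h x‖) 2 (volume : Measure Plane) := (Lp.memLp h).norm.const_mul b
  have h1 : ‖f‖ ≤ ‖hg.toLp + hh.toLp‖ := by
    apply Lp.norm_le_norm_of_ae_le
    filter_upwards [H, Lp.coeFn_add hg.toLp hh.toLp, hg.coeFn_toLp, hh.coeFn_toLp]
      with x h1 h2 h3 h4
    rw [h2, Pi.add_apply, h3, h4]
    exact h1.trans (le_abs_self _)
  have e : ∀ (c : ℝ) (k : L2) (hk : MemLp (fun x => c * ‖k x‖) 2 (volume : Measure Plane)),
      0 ≤ c → ‖hk.toLp‖ ≤ c * ‖k‖ := by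
    intro c k hk hc
    apply Lp.norm_le_mul_norm_of_ae_le_mul
    filter_upwards [hk.coeFn_toLp] with x hx
    rw [hx, norm_mul, norm_norm, Real.norm_of_nonneg hc]
  exact h1.trans ((norm_add_le _ _).trans (add_le_add (e a g hg ha) (e b h hh hb)))

/-- The Fourier multiplier with a bounded symbol, as an operator on `L²`. -/
def fourierMul (m : Lp ℂ ∞ (volume : Measure Plane)) (f : L2) : L2 := 𝓕⁻ ((m • (𝓕 f : L2) : L2))

theorem norm_fourierInv (f : L2) : ‖(𝓕⁻ f : L2)‖ = ‖f‖ :=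
  (Lp.fourierTransformₗᵢ Plane ℂ).symm.norm_map f

theorem fourier_fourierMul (m : Lp ℂ ∞ (volume : Measure Plane)) (f : L2) :
    (𝓕 (fourierMul m f) : L2) = m • (𝓕 f : L2) := fourier_fourierInv_eq _

theorem coeFn_fourier_fourierMul (m : Lp ℂ ∞ (volume : Measure Plane)) (f : L2) :
    (𝓕 (fourierMul m f) : L2) =ᵐ[volume] fun ξ => m ξ * (𝓕 f : L2) ξ := by
  rw [fourier_fourierMul]
  exact Lp.coeFn_lpSMul _ _

theorem fourierMul_add (m : Lp ℂ ∞ (volume : Measure Plane)) (f g : L2) :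
    fourierMul m (f + g) = fourierMul m f + fourierMul m g := by
  unfold fourierMul
  rw [FourierTransform.fourier_add, Lp.add_smul, FourierTransform.fourierInv_add]

theorem fourierMul_smul (m : Lp ℂ ∞ (volume : Measure Plane)) (c : ℂ) (f : L2) :
    fourierMul m (c • f) = c • fourierMul m f := by
  unfold fourierMul
  rw [FourierTransform.fourier_smul, ← FourierTransform.fourierInv_smul]
  congr 1
  rw [Lp.smul_comm]

theorem norm_fourierMul_le (m : Lp ℂ ∞ (volume : Measure Plane)) (f : L2) :
    ‖fourierMul m f‖ ≤ ‖m‖ * ‖f‖ := by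
  unfold fourierMul
  rw [norm_fourierInv]
  exact (Lp.norm_smul_le _ _).trans (by rw [Lp.norm_fourier_eq])

/-! ### Translations and weak derivatives on the Fourier side -/

theorem shift_toLp (a : Plane) (φ : 𝓢(Plane, ℂ)) :
    shift a (φ.toLp 2) = (φ.compSubConstCLM ℂ (-a)).toLp 2 := by
  apply Lp.ext
  have h := (measurePreserving_add_right (volume : Measure Plane) a).quasiMeasurePreserving.ae_eq
    (φ.coeFn_toLp 2)
  filter_upwards [coeFn_shift a (φ.toLp 2), h, (φ.compSubConstCLM ℂ (-a)).coeFn_toLp 2]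
    with x h1 h2 h3
  rw [h1, h3]
  simpa using h2

theorem shift_add (a : Plane) (f g : L2) : shift a (f + g) = shift a f + shift a g :=
  map_add (Lp.compMeasurePreserving (fun x => x + a) (measurePreserving_add_right volume a)) f g

theorem shift_smul (a : Plane) (c : ℂ) (f : L2) : shift a (c • f) = c • shift a f := by
  apply Lp.ext
  have h := (measurePreserving_add_right (volume : Measure Plane) a).quasiMeasurePreserving.ae_eq
    (Lp.coeFn_smul c f)
  filter_upwards [coeFn_shift a f, h, coeFn_shift a (c • f), Lp.coeFn_smul c (shift a f)]
    with x h1 h2 h3 h4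
  rw [h3, h4]
  simpa [h1] using h2

theorem norm_shift (a : Plane) (f : L2) : ‖shift a f‖ = ‖f‖ :=
  Lp.norm_compMeasurePreserving _ _

theorem continuous_shift (a : Plane) : Continuous (shift a) :=
  (Lp.isometry_compMeasurePreserving (measurePreserving_add_right volume a)).continuous

/-- The character `ξ ↦ exp (2πi ⟨a, ξ⟩)`. -/
def character (a ξ : Plane) : ℂ := (Real.fourierChar (inner ℝ a ξ) : ℂ)

theorem continuous_character (a : Plane) : Continuous (character a) := by
  unfold character
  fun_prop

theorem norm_character (a ξ : Plane) : ‖character a ξ‖ = 1 := by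
  unfold character
  exact Circle.norm_coe _

theorem memLp_character (a : Plane) : MemLp (character a) ∞ (volume : Measure Plane) :=
  memLp_top_of_bound (continuous_character a).aestronglyMeasurable 1
    (Eventually.of_forall fun ξ => (norm_character a ξ).le)

/-- Both sides are continuous in `f`, so the classical formula for Schwartz functions extends by
density. -/
theorem fourier_shift_eq (a : Plane) (f : L2) :
    (𝓕 (shift a f) : L2) = (memLp_character a).toLp (character a) • (𝓕 f : L2) := by
  have hc : Continuous fun f : L2 => (𝓕 f : L2) := (Lp.fourierTransformₗᵢ Plane ℂ).continuous
  refine DenseRange.induction_on (SchwartzMap.denseRange_toLpCLM (p := 2) ENNReal.ofNat_ne_top) f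
    (isClosed_eq (hc.comp (continuous_shift a)) ?_) fun φ => ?_
  · refine (LipschitzWith.of_dist_le' (K := ‖(memLp_character a).toLp (character a)‖)
      fun f g => ?_).continuous
    rw [dist_eq_norm, dist_eq_norm]
    have : (memLp_character a).toLp (character a) • (𝓕 f : L2)
        - (memLp_character a).toLp (character a) • (𝓕 g : L2)
        = (memLp_character a).toLp (character a) • (𝓕 (f - g) : L2) := by
      have e : (𝓕 (f - g) : L2) = 𝓕 f - 𝓕 g := (Lp.fourierTransformₗᵢ Plane ℂ).map_sub f g
      rw [e, sub_eq_add_neg, sub_eq_add_neg, ← Lp.smul_neg, ← Lp.add_smul]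
    rw [this]
    exact (Lp.norm_smul_le _ _).trans (by rw [Lp.norm_fourier_eq])
  · simp only [SchwartzMap.toLpCLM_apply]
    rw [shift_toLp, SchwartzMap.toLp_fourier_eq, SchwartzMap.toLp_fourier_eq]
    apply Lp.ext
    filter_upwards [(𝓕 (φ.compSubConstCLM ℂ (-a))).coeFn_toLp 2, (𝓕 φ).coeFn_toLp 2,
      (memLp_character a).coeFn_toLp,
      Lp.coeFn_lpSMul (r := 2) ((memLp_character a).toLp (character a)) ((𝓕 φ).toLp 2)]
      with ξ h1 h2 h3 h4
    rw [h1, h4, Pi.smul_apply', h2, h3, SchwartzMap.fourier_coe, SchwartzMap.fourier_coe]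
    have := congrFun (VectorFourier.fourierIntegral_comp_add_right Real.fourierChar
      (volume : Measure Plane) (innerₗ Plane) φ a) ξ
    have e : (⇑(φ.compSubConstCLM ℂ (-a)) : Plane → ℂ) = fun x => φ (x + a) := by
      ext x; simp
    rw [e]
    exact this

theorem coeFn_fourier_shift (a : Plane) (f : L2) :
    (𝓕 (shift a f) : L2) =ᵐ[volume] fun ξ => character a ξ * (𝓕 f : L2) ξ := by
  rw [fourier_shift_eq]
  filter_upwards [Lp.coeFn_lpSMul (r := 2) ((memLp_character a).toLp (character a)) (𝓕 f : L2),
    (memLp_character a).coeFn_toLp] with ξ h1 h2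
  rw [h1, Pi.smul_apply', h2, smul_eq_mul]

theorem fourier_injective {f g : L2} (h : (𝓕 f : L2) = 𝓕 g) : f = g :=
  (Lp.fourierTransformₗᵢ Plane ℂ).injective h

theorem fourierMul_shift (m : Lp ℂ ∞ (volume : Measure Plane)) (a : Plane) (f : L2) :
    fourierMul m (shift a f) = shift a (fourierMul m f) := by
  apply fourier_injective
  apply Lp.ext
  filter_upwards [coeFn_fourier_fourierMul m (shift a f), coeFn_fourier_shift a f,
    coeFn_fourier_shift a (fourierMul m f), coeFn_fourier_fourierMul m f] with ξ h1 h2 h3 h4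
  rw [h1, h2, h3, h4]
  ring

/-- The symbol `2πi ξᵢ` of the partial derivative `∂ᵢ`. -/
def derivSymbol (i : Fin 2) (ξ : Plane) : ℂ := 2 * Real.pi * Complex.I * (ξ i : ℂ)

theorem continuous_derivSymbol (i : Fin 2) : Continuous (derivSymbol i) := by
  unfold derivSymbol
  fun_prop

/-- Weak derivatives in terms of the Fourier transform. -/
theorem isWeakPartial_iff_fourier (i : Fin 2) (u g : L2) :
    IsWeakPartial i u g ↔
      (𝓕 g : L2) =ᵐ[volume] fun ξ => derivSymbol i ξ * (𝓕 u : L2) ξ := by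
  -- The Fourier transform is injective on tempered distributions and turns the derivative into
  -- multiplication by 2πi times the coordinate.
  have h0 : IsWeakPartial i u g ↔ (2 * Real.pi * Complex.I) • TemperedDistribution.smulLeftCLM ℂ
      (fun ξ : Plane => ((inner ℝ ξ (EuclideanSpace.single i (1 : ℝ)) : ℝ) : ℂ))
        ((𝓕 u : L2) : 𝓢'(Plane, ℂ)) = ((𝓕 g : L2) : 𝓢'(Plane, ℂ)) := by
    unfold IsWeakPartial
    rw [← Lp.fourier_toTemperedDistribution_eq, ← Lp.fourier_toTemperedDistribution_eq,
      ← TemperedDistribution.fourier_lineDerivOp_eq]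
    exact ⟨fun h => congrArg _ h, fun h => by
      simpa using congrArg (fun T : 𝓢'(Plane, ℂ) => 𝓕⁻ T) h⟩
  have hT : (fun ξ : Plane =>
      ((inner ℝ ξ (EuclideanSpace.single i (1 : ℝ)) : ℝ) : ℂ)).HasTemperateGrowth := by
    fun_prop
  have h1 : ∀ φ : 𝓢(Plane, ℂ), ((2 * Real.pi * Complex.I) • TemperedDistribution.smulLeftCLM ℂ
      (fun ξ : Plane => ((inner ℝ ξ (EuclideanSpace.single i (1 : ℝ)) : ℝ) : ℂ))
        ((𝓕 u : L2) : 𝓢'(Plane, ℂ))) φ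
      = ∫ ξ, φ ξ • (derivSymbol i ξ * (𝓕 u : L2) ξ) := by
    intro φ
    simp only [smul_apply, TemperedDistribution.smulLeftCLM_apply_apply,
      Lp.toTemperedDistribution_apply]
    rw [← integral_smul]
    congr 1
    ext ξ
    rw [SchwartzMap.smulLeftCLM_apply_apply hT]
    simp [derivSymbol, EuclideanSpace.inner_single_right]
    ring
  have hloc : LocallyIntegrable (fun ξ => derivSymbol i ξ * (𝓕 u : L2) ξ)
      (volume : Measure Plane) :=
    (locallyIntegrable_coe _).continuous_mul (continuous_derivSymbol i)
  rw [h0]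
  constructor
  · intro h
    refine ae_eq_of_integral_schwartz_smul_eq (locallyIntegrable_coe _) hloc fun φ => ?_
    rw [← h1 φ, h, Lp.toTemperedDistribution_apply]
  · intro h
    ext φ
    rw [h1 φ, Lp.toTemperedDistribution_apply]
    apply integral_congr_ae
    filter_upwards [h] with ξ hξ
    rw [hξ]

theorem IsWeakPartial.fourierMul {i : Fin 2} {u g : L2} (h : IsWeakPartial i u g)
    (m : Lp ℂ ∞ (volume : Measure Plane)) : IsWeakPartial i (fourierMul m u) (fourierMul m g) := by
  rw [isWeakPartial_iff_fourier] at h ⊢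
  filter_upwards [h, coeFn_fourier_fourierMul m u, coeFn_fourier_fourierMul m g] with ξ h1 h2 h3
  rw [h3, h2, h1]
  ring

/-! ### The Hilbert space `H¹` and its translations -/

/-- The embedding of `H¹` into `L²`. -/
def toL2CLM : H1 →L[ℂ] L2 :=
  (WithLp.fstL 2 ℂ L2 (PiLp 2 fun _ : Fin 2 => L2)).comp sobolevSubmodule.subtypeL

theorem toL2CLM_apply (u : H1) : toL2CLM u = toL2 u := rfl

/-- The weak partial derivative, as an operator from `H¹` to `L²`. -/
def gradCLM (i : Fin 2) : H1 →L[ℂ] L2 :=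
  (PiLp.proj 2 (fun _ : Fin 2 => L2) i).comp
    ((WithLp.sndL 2 ℂ L2 (PiLp 2 fun _ : Fin 2 => L2)).comp sobolevSubmodule.subtypeL)

theorem gradCLM_apply (i : Fin 2) (u : H1) : gradCLM i u = grad u i := rfl

theorem toL2_sub (u w : H1) : toL2 (u - w) = toL2 u - toL2 w := map_sub toL2CLM u w

theorem toL2_add (u w : H1) : toL2 (u + w) = toL2 u + toL2 w := map_add toL2CLM u w

theorem toL2_zero : toL2 0 = 0 := map_zero toL2CLM

theorem inner_eq (u w : H1) : inner ℂ u w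
    = inner ℂ (toL2 u) (toL2 w) + (inner ℂ (grad u 0) (grad w 0) + inner ℂ (grad u 1) (grad w 1)) := by
  rw [Submodule.coe_inner, WithLp.prod_inner_apply, PiLp.inner_apply, Fin.sum_univ_two]
  rfl

theorem norm_grad_sq (u : H1) : ‖grad u‖ ^ 2 = ‖grad u 0‖ ^ 2 + ‖grad u 1‖ ^ 2 := by
  rw [PiLp.norm_sq_eq_of_L2, Fin.sum_univ_two]

theorem norm_sq_eq (u : H1) : ‖u‖ ^ 2 = ‖toL2 u‖ ^ 2 + ‖grad u‖ ^ 2 :=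
  WithLp.prod_norm_sq_eq_of_L2 (u : Pairs)

theorem norm_toL2_le (u : H1) : ‖toL2 u‖ ≤ ‖u‖ := by
  have := norm_sq_eq u
  exact le_of_sq_le_sq (by nlinarith [sq_nonneg ‖grad u‖]) (norm_nonneg _)

theorem norm_grad_le (u : H1) : ‖grad u‖ ≤ ‖u‖ := by
  have := norm_sq_eq u
  exact le_of_sq_le_sq (by nlinarith [sq_nonneg ‖toL2 u‖]) (norm_nonneg _)

theorem isClosed_sobolevSubmodule : IsClosed (sobolevSubmodule : Set Pairs) := by
  have : (sobolevSubmodule : Set Pairs) = ⋂ i, {p | IsWeakPartial i p.fst (p.snd i)} := by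
    ext p
    simp [sobolevSubmodule]
  rw [this]
  refine isClosed_iInter fun i => ?_
  unfold IsWeakPartial
  simp only [← Lp.toTemperedDistributionCLM_apply]
  refine isClosed_eq ?_ ?_
  · exact (lineDerivOpCLM ℂ 𝓢'(Plane, ℂ) (EuclideanSpace.single i (1 : ℝ) : Plane) ∘L
      Lp.toTemperedDistributionCLM ℂ volume 2 ∘L
        WithLp.fstL 2 ℂ L2 (PiLp 2 fun _ : Fin 2 => L2)).continuous
  · exact (Lp.toTemperedDistributionCLM ℂ volume 2 ∘L PiLp.proj 2 (fun _ : Fin 2 => L2) i ∘L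
        WithLp.sndL 2 ℂ L2 (PiLp 2 fun _ : Fin 2 => L2)).continuous

instance completeSpace_H1 : CompleteSpace H1 := isClosed_sobolevSubmodule.completeSpace_coe

instance secondCountableTopology_H1 : SecondCountableTopology H1 := by
  have : Fact ((2 : ℝ≥0∞) ≠ ∞) := ⟨by norm_num⟩
  have : SecondCountableTopology L2 := inferInstance
  have : SecondCountableTopology Pairs := inferInstance
  infer_instance

theorem toL2_translate (a : Plane) (u : H1) : toL2 (translate a u) = shift a (toL2 u) := rfl

theorem grad_translate (a : Plane) (u : H1) (i : Fin 2) :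
    grad (translate a u) i = shift a (grad u i) := rfl

theorem H1_ext {u w : H1} (h : toL2 u = toL2 w) (h' : ∀ i, grad u i = grad w i) : u = w := by
  apply Subtype.ext
  apply WithLp.ofLp_injective
  exact Prod.ext h (WithLp.ofLp_injective 2 (funext h'))

theorem shift_shift (a b : Plane) (f : L2) : shift a (shift b f) = shift (a + b) f := by
  apply fourier_injective
  apply Lp.ext
  filter_upwards [coeFn_fourier_shift a (shift b f), coeFn_fourier_shift b f,
    coeFn_fourier_shift (a + b) f] with ξ h1 h2 h3
  rw [h1, h2, h3, ← mul_assoc]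
  simp [character, inner_add_left, AddChar.map_add_eq_mul]

theorem shift_zero (f : L2) : shift 0 f = f := by
  apply fourier_injective
  apply Lp.ext
  filter_upwards [coeFn_fourier_shift 0 f] with ξ h1
  rw [h1]
  simp [character]

theorem translate_translate (a b : Plane) (u : H1) :
    translate a (translate b u) = translate (a + b) u :=
  H1_ext (shift_shift _ _ _) fun _ => shift_shift _ _ _

theorem translate_zero (u : H1) : translate 0 u = u :=
  H1_ext (shift_zero _) fun _ => shift_zero _

/-- Translation as a linear isometry of `H¹`. -/
def translateₗᵢ (a : Plane) : H1 →ₗᵢ[ℂ] H1 where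
  toFun := translate a
  map_add' u w := H1_ext (shift_add a _ _) fun _ => shift_add a _ _
  map_smul' c u := H1_ext (shift_smul a c _) fun _ => shift_smul a c _
  norm_map' u := by
    have h : ‖translate a u‖ ^ 2 = ‖u‖ ^ 2 := by
      simp only [norm_sq_eq, norm_grad_sq, toL2_translate, grad_translate, norm_shift]
    exact (sq_eq_sq₀ (norm_nonneg _) (norm_nonneg _)).1 h

theorem norm_translate (a : Plane) (u : H1) : ‖translate a u‖ = ‖u‖ := (translateₗᵢ a).norm_map u

theorem translate_sub (a : Plane) (u w : H1) :
    translate a (u - w) = translate a u - translate a w := (translateₗᵢ a).map_sub u w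

theorem norm_toL2_translate (a : Plane) (u : H1) : ‖toL2 (translate a u)‖ = ‖toL2 u‖ :=
  norm_shift _ _

theorem norm_grad_translate (a : Plane) (u : H1) : ‖grad (translate a u)‖ = ‖grad u‖ := by
  have h : ‖grad (translate a u)‖ ^ 2 = ‖grad u‖ ^ 2 := by
    simp only [norm_grad_sq, grad_translate, norm_shift]
  exact (sq_eq_sq₀ (norm_nonneg _) (norm_nonneg _)).1 h

theorem inner_translate_right (a : Plane) (u w : H1) :
    inner ℂ u (translate a w) = inner ℂ (translate (-a) u) w := by
  have h := LinearIsometry.inner_map_map (𝕜 := ℂ) (E := H1) (E' := H1) (translateₗᵢ a) (translate (-a) u) w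
  have e : translateₗᵢ a (translate (-a) u) = u := by
    change translate a (translate (-a) u) = u
    rw [translate_translate, add_neg_cancel, translate_zero]
  rw [e] at h
  exact h

theorem continuous_shift_left (f : L2) : Continuous fun a => shift a f := by
  let G : C(Plane × Plane, Plane) := ⟨fun p => p.2 + p.1, by fun_prop⟩
  have h : Continuous fun a : Plane => G.curry a := G.curry.continuous
  exact (continuous_const (y := f)).compMeasurePreservingLp h
    (fun a => measurePreserving_add_right volume a) (by norm_num)

theorem continuous_translate_left (u : H1) : Continuous fun a => translate a u := by
  apply Continuous.subtype_mk
  apply (WithLp.prod_continuous_toLp 2 _ _).comp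
  refine (continuous_shift_left _).prodMk ?_
  apply (PiLp.continuous_toLp 2 _).comp
  exact continuous_pi fun i => continuous_shift_left _

/-! ### Density of Schwartz functions in `H¹` -/

theorem isWeakPartial_toLp (φ : 𝓢(Plane, ℂ)) (i : Fin 2) : IsWeakPartial i (φ.toLp 2)
    ((∂_{(EuclideanSpace.single i (1 : ℝ) : Plane)} φ : 𝓢(Plane, ℂ)).toLp 2) := by
  unfold IsWeakPartial
  rw [Lp.toTemperedDistribution_toLp_eq, Lp.toTemperedDistribution_toLp_eq]
  exact TemperedDistribution.lineDerivOp_toTemperedDistributionCLM_eq φ _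

/-- The element of `H¹` with a given weak gradient. -/
def ofWeakPartial (u : L2) (g : Fin 2 → L2) (h : ∀ i, IsWeakPartial i u (g i)) : H1 :=
  ⟨WithLp.toLp 2 (u, WithLp.toLp 2 g), h⟩

/-- The element of `H¹` given by a Schwartz function. -/
def ofSchwartz (φ : 𝓢(Plane, ℂ)) : H1 :=
  ofWeakPartial _ _ (isWeakPartial_toLp φ)

theorem toL2_ofSchwartz (φ : 𝓢(Plane, ℂ)) : toL2 (ofSchwartz φ) = φ.toLp 2 := rfl

theorem grad_ofSchwartz (φ : 𝓢(Plane, ℂ)) (i : Fin 2) : grad (ofSchwartz φ) i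
    = (∂_{(EuclideanSpace.single i (1 : ℝ) : Plane)} φ : 𝓢(Plane, ℂ)).toLp 2 := rfl

theorem coeFn_fourier_grad (u : H1) (i : Fin 2) :
    (𝓕 (grad u i) : L2) =ᵐ[volume] fun ξ => derivSymbol i ξ * (𝓕 (toL2 u) : L2) ξ :=
  (isWeakPartial_iff_fourier i _ _).1 (u.2 i)

/-- On the Fourier side the `H¹` inner product carries the weight 1 + 4π²|ξ|². Testing against
inverse transforms of test functions shows that the weight times the transform of `u` vanishes, and
the weight has no zeros. -/
theorem fourier_toL2_eq_zero_of_orthogonal {u : H1} (h : ∀ φ, inner ℂ (ofSchwartz φ) u = 0) :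
    (𝓕 (toL2 u) : L2) =ᵐ[volume] 0 := by
  have hsym : ∀ ξ : Plane, (1 + ‖derivSymbol 0 ξ‖ ^ 2 + ‖derivSymbol 1 ξ‖ ^ 2 : ℝ) ≠ 0 := by
    intro ξ; positivity
  have hloc : LocallyIntegrable (fun ξ : Plane =>
      ((1 + ‖derivSymbol 0 ξ‖ ^ 2 + ‖derivSymbol 1 ξ‖ ^ 2 : ℝ) : ℂ) * (𝓕 (toL2 u) : L2) ξ)
      (volume : Measure Plane) := by
    refine (locallyIntegrable_coe _).continuous_mul ?_
    have := continuous_derivSymbol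
    fun_prop
  have key : (fun ξ : Plane =>
      ((1 + ‖derivSymbol 0 ξ‖ ^ 2 + ‖derivSymbol 1 ξ‖ ^ 2 : ℝ) : ℂ) * (𝓕 (toL2 u) : L2) ξ)
      =ᵐ[volume] 0 := by
    apply ae_eq_zero_of_integral_contDiff_smul_eq_zero hloc
    intro k hk hk'
    have h1 : ContDiff ℝ (⊤ : ℕ∞) fun x => (k x : ℂ) := Complex.ofRealCLM.contDiff.comp hk
    have h2 : HasCompactSupport fun x => (k x : ℂ) := hk'.comp_left Complex.ofReal_zero
    set ψ : 𝓢(Plane, ℂ) := h2.toSchwartzMap h1 with hψ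
    have hφ := h (𝓕⁻ ψ)
    rw [inner_eq, ← Lp.inner_fourier_eq, ← Lp.inner_fourier_eq (grad _ 0),
      ← Lp.inner_fourier_eq (grad _ 1), L2.inner_def, L2.inner_def, L2.inner_def,
      ← integral_add (L2.integrable_inner _ _) (L2.integrable_inner _ _),
      ← integral_add (L2.integrable_inner _ _)
        ((L2.integrable_inner _ _).add (L2.integrable_inner _ _))] at hφ
    rw [← hφ]
    apply integral_congr_ae
    have e0 : (𝓕 (toL2 (ofSchwartz (𝓕⁻ ψ))) : L2) = ψ.toLp 2 := by
      rw [toL2_ofSchwartz, SchwartzMap.toLp_fourier_eq, fourier_fourierInv_eq]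
    have g := coeFn_fourier_grad (ofSchwartz (𝓕⁻ ψ))
    have g' := coeFn_fourier_grad u
    have hψ2 := ψ.coeFn_toLp 2 volume
    rw [← e0] at hψ2
    filter_upwards [hψ2, g 0, g 1, g' 0, g' 1] with ξ a0 a1 a2 a3 a4
    have hk0 : ψ ξ = (k ξ : ℂ) := rfl
    rw [a1, a2, a3, a4, a0, hk0]
    simp only [RCLike.inner_apply, map_mul, Complex.conj_ofReal, Complex.real_smul]
    push_cast
    rw [← Complex.mul_conj', ← Complex.mul_conj']
    ring
  filter_upwards [key] with ξ hξ
  rcases mul_eq_zero.1 hξ with h0 | h0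
  · exact absurd (Complex.ofReal_eq_zero.1 h0) (hsym ξ)
  · exact h0

theorem ofSchwartz_add (φ ψ : 𝓢(Plane, ℂ)) :
    ofSchwartz (φ + ψ) = ofSchwartz φ + ofSchwartz ψ := by
  have h := map_add (SchwartzMap.toLpCLM ℂ (E := Plane) ℂ 2 volume)
  refine H1_ext ?_ fun i => ?_
  · rw [toL2_add, toL2_ofSchwartz, toL2_ofSchwartz, toL2_ofSchwartz]
    exact h φ ψ
  · rw [← gradCLM_apply, ← gradCLM_apply, map_add, gradCLM_apply, gradCLM_apply, gradCLM_apply,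
      grad_ofSchwartz, grad_ofSchwartz, grad_ofSchwartz, lineDerivOp_add]
    exact h _ _

theorem ofSchwartz_smul (c : ℂ) (φ : 𝓢(Plane, ℂ)) : ofSchwartz (c • φ) = c • ofSchwartz φ := by
  have h := map_smul (SchwartzMap.toLpCLM ℂ (E := Plane) ℂ 2 volume) c
  refine H1_ext ?_ fun i => ?_
  · rw [← toL2CLM_apply (c • _), map_smul, toL2CLM_apply, toL2_ofSchwartz, toL2_ofSchwartz]
    exact h φ
  · rw [← gradCLM_apply, ← gradCLM_apply, map_smul, gradCLM_apply, gradCLM_apply,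
      grad_ofSchwartz, grad_ofSchwartz, lineDerivOp_smul]
    exact h _

/-- The range is a subspace of a Hilbert space, so it is enough that its orthogonal complement is
trivial. -/
theorem denseRange_ofSchwartz : DenseRange ofSchwartz := by
  let L : 𝓢(Plane, ℂ) →ₗ[ℂ] H1 :=
    { toFun := ofSchwartz, map_add' := ofSchwartz_add, map_smul' := ofSchwartz_smul }
  have : (LinearMap.range L).topologicalClosure = ⊤ := by
    refine (Submodule.topologicalClosure_eq_top_iff (𝕜 := ℂ) (E := H1)).2 (eq_bot_iff.2 ?_)
    intro u hu
    rw [Submodule.mem_orthogonal] at hu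
    have h0 : toL2 u = 0 := by
      apply fourier_injective
      apply Lp.ext
      refine (fourier_toL2_eq_zero_of_orthogonal fun φ => hu _ ⟨φ, rfl⟩).trans ?_
      have : (𝓕 (0 : L2) : L2) = 0 := (Lp.fourierTransformₗᵢ Plane ℂ).map_zero
      rw [this]
      exact (Lp.coeFn_zero _ _ _).symm
    have h1 : ∀ i, grad u i = 0 := by
      intro i
      have h2 : IsWeakPartial i (toL2 u) (grad u i) := u.2 i
      have h3 : IsWeakPartial i (0 : L2) 0 := (0 : H1).2 i
      rw [isWeakPartial_iff_fourier] at h2 h3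
      rw [h0] at h2
      exact fourier_injective (Lp.ext (h2.trans h3.symm))
    exact (Submodule.mem_bot ℂ).2 (H1_ext h0 h1)
  have h2 := Submodule.dense_iff_topologicalClosure_eq_top.2 this
  exact h2

/-! ### Sobolev embedding and the Gagliardo–Nirenberg inequality -/

theorem opNorm_le_single (D : Plane →L[ℝ] ℂ) :
    ‖D‖ ≤ ‖D (EuclideanSpace.single 0 1)‖ + ‖D (EuclideanSpace.single 1 1)‖ := by
  refine D.opNorm_le_bound (by positivity) fun x => ?_
  have hx : x = x 0 • EuclideanSpace.single 0 (1 : ℝ) + x 1 • EuclideanSpace.single 1 (1 : ℝ) := by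
    ext i
    fin_cases i <;> simp
  conv_lhs => rw [hx, map_add, map_smul, map_smul]
  refine (norm_add_le _ _).trans ?_
  rw [norm_smul, norm_smul, add_mul, mul_comm ‖x 0‖, mul_comm ‖x 1‖]
  gcongr <;> exact PiLp.norm_apply_le x _

/-- A smooth cutoff function on the plane. -/
def cutoff : ContDiffBump (0 : Plane) := ⟨1, 2, one_pos, one_lt_two⟩

theorem exists_norm_fderiv_cutoff_le : ∃ c, 0 ≤ c ∧ ∀ x, ‖fderiv ℝ cutoff x‖ ≤ c := by
  have h1 : ContDiff ℝ 1 cutoff := cutoff.contDiff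
  obtain ⟨c, hc⟩ := (cutoff.hasCompactSupport.fderiv ℝ).exists_bound_of_continuous
    (h1.continuous_fderiv (by norm_num))
  exact ⟨c, (norm_nonneg _).trans (hc 0), hc⟩

/-- The square of a function after multiplication with a cutoff at scale `r⁻¹`. -/
def cutoffSq (r : ℝ) (φ : 𝓢(Plane, ℂ)) (x : Plane) : ℂ := ((cutoff (r • x) : ℂ) * φ x) ^ 2

theorem contDiff_cutoffSq (r : ℝ) (φ : 𝓢(Plane, ℂ)) : ContDiff ℝ 1 (cutoffSq r φ) := by
  have h1 : ContDiff ℝ 1 fun x : Plane => (cutoff (r • x) : ℂ) :=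
    Complex.ofRealCLM.contDiff.comp (cutoff.contDiff.comp (contDiff_const_smul r))
  exact (h1.mul (φ.smooth 1)).pow 2

theorem hasCompactSupport_cutoffSq {r : ℝ} (hr : r ≠ 0) (φ : 𝓢(Plane, ℂ)) :
    HasCompactSupport (cutoffSq r φ) := by
  have h0 : HasCompactSupport fun x : Plane => cutoff (r • x) :=
    cutoff.hasCompactSupport.comp_homeomorph (Homeomorph.smulOfNeZero r hr)
  have h1 : HasCompactSupport fun x : Plane => (cutoff (r • x) : ℂ) := h0.comp_left Complex.ofReal_zero
  exact (h1.mul_right (f' := φ)).comp_left (g := fun z => z ^ 2) (by simp)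

theorem norm_fderiv_cutoffSq_le {c r : ℝ} (hc : ∀ x, ‖fderiv ℝ cutoff x‖ ≤ c) (hr : 0 ≤ r)
    (φ : 𝓢(Plane, ℂ)) (x : Plane) : ‖fderiv ℝ (cutoffSq r φ) x‖ ≤
      ‖2 * φ x‖ * (‖(∂_{(EuclideanSpace.single 0 (1 : ℝ) : Plane)} φ : 𝓢(Plane, ℂ)) x‖
        + ‖(∂_{(EuclideanSpace.single 1 (1 : ℝ) : Plane)} φ : 𝓢(Plane, ℂ)) x‖
        + ‖((c * r : ℝ) : ℂ) * φ x‖) := by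
  have hc0 : 0 ≤ c := (norm_nonneg _).trans (hc 0)
  have hχ1 : ‖(cutoff (r • x) : ℂ)‖ ≤ 1 := by
    rw [Complex.norm_real, Real.norm_of_nonneg cutoff.nonneg]; exact cutoff.le_one
  have hd : DifferentiableAt ℝ cutoff (r • x) :=
    (cutoff.contDiff (n := 1)).differentiable (by norm_num) _
  have hs : HasFDerivAt (fun y : Plane => r • y) (r • ContinuousLinearMap.id ℝ Plane) x :=
    (hasFDerivAt_id x).const_smul r
  have h1 := hd.hasFDerivAt.comp x hs
  have h2 := Complex.ofRealCLM.hasFDerivAt.comp x h1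
  have hb : ‖Complex.ofRealCLM ∘L (fderiv ℝ cutoff (r • x) ∘L
      (r • ContinuousLinearMap.id ℝ Plane))‖ ≤ c * r := by
    refine (ContinuousLinearMap.opNorm_comp_le _ _).trans ?_
    rw [Complex.ofRealCLM_norm, one_mul]
    refine (ContinuousLinearMap.opNorm_comp_le _ _).trans ?_
    refine mul_le_mul (hc _) ?_ (norm_nonneg _) hc0
    rw [norm_smul, Real.norm_of_nonneg hr]
    exact mul_le_of_le_one_right hr ContinuousLinearMap.norm_id_le
  have h3 := (h2.mul (φ.hasFDerivAt x)).pow 2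
  have h4 : fderiv ℝ (cutoffSq r φ) x = _ := h3.fderiv
  rw [h4]
  simp only [Function.comp_apply, Complex.ofRealCLM_apply]
  rw [norm_smul]
  have hD : ‖fderiv ℝ φ x‖ ≤ ‖(∂_{(EuclideanSpace.single 0 (1 : ℝ) : Plane)} φ : 𝓢(Plane, ℂ)) x‖
        + ‖(∂_{(EuclideanSpace.single 1 (1 : ℝ) : Plane)} φ : 𝓢(Plane, ℂ)) x‖ := by
    rw [SchwartzMap.lineDerivOp_apply_eq_fderiv, SchwartzMap.lineDerivOp_apply_eq_fderiv]
    exact opNorm_le_single _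
  refine mul_le_mul ?_ ?_ (norm_nonneg _) (norm_nonneg _)
  · simp only [Nat.cast_ofNat, Nat.add_one_sub_one, pow_one, Pi.mul_apply,
      Function.comp_apply, Complex.ofRealCLM_apply, norm_mul, nsmul_eq_mul]
    have := mul_le_mul_of_nonneg_right hχ1 (norm_nonneg (φ x))
    simp only [Complex.norm_ofNat]
    linarith
  · refine (norm_add_le _ _).trans (add_le_add ?_ ?_)
    · rw [norm_smul]
      exact (mul_le_of_le_one_left (norm_nonneg _) hχ1).trans hD
    · rw [norm_smul, norm_mul, mul_comm, Complex.norm_real, Real.norm_of_nonneg (by positivity)]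
      exact mul_le_mul_of_nonneg_right hb (norm_nonneg _)

theorem eLpNorm_schwartz (φ : 𝓢(Plane, ℂ)) : eLpNorm φ 2 volume = ENNReal.ofReal ‖φ.toLp 2‖ := by
  rw [ofReal_norm, Lp.enorm_def]
  exact eLpNorm_congr_ae (φ.coeFn_toLp 2).symm

/-- In dimension two the Sobolev inequality for an `L¹` gradient has target exponent 2. Applied to a
square, whose derivative is a product, it gives a product of `L²` norms by Hölder. The `c * r` term
is the price of the compact support that the inequality requires. -/
theorem eLpNorm_cutoffSq_le {c r : ℝ} (hc : ∀ x, ‖fderiv ℝ cutoff x‖ ≤ c) (hr : 0 < r)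
    (φ : 𝓢(Plane, ℂ)) : eLpNorm (cutoffSq r φ) 2 volume ≤
      eLpNormLESNormFDerivOneConst (volume : Measure Plane) (2 : NNReal) *
      ENNReal.ofReal (2 * ‖toL2 (ofSchwartz φ)‖ * (‖grad (ofSchwartz φ) 0‖
        + ‖grad (ofSchwartz φ) 1‖ + c * r * ‖toL2 (ofSchwartz φ)‖)) := by
  have hc0 : 0 ≤ c := (norm_nonneg _).trans (hc 0)
  have hp : NNReal.HolderConjugate (Module.finrank ℝ Plane : NNReal) 2 := by
    rw [finrank_euclideanSpace_fin]
    exact_mod_cast (NNReal.HolderConjugate.two_two)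
  have h0 := eLpNorm_le_eLpNorm_fderiv_one (volume : Measure Plane) (contDiff_cutoffSq r φ)
    (hasCompactSupport_cutoffSq hr.ne' φ) hp
  refine h0.trans ?_
  gcongr
  set ψ₀ : 𝓢(Plane, ℂ) := ∂_{(EuclideanSpace.single 0 (1 : ℝ) : Plane)} φ with hψ₀
  set ψ₁ : 𝓢(Plane, ℂ) := ∂_{(EuclideanSpace.single 1 (1 : ℝ) : Plane)} φ with hψ₁
  have m : ∀ ψ : 𝓢(Plane, ℂ), AEStronglyMeasurable (fun x => ‖ψ x‖) (volume : Measure Plane) :=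
    fun ψ => ψ.continuous.norm.aestronglyMeasurable
  have mφ : AEStronglyMeasurable (fun x => ‖((c * r : ℝ) : ℂ) * φ x‖) (volume : Measure Plane) :=
    (continuous_const.mul φ.continuous).norm.aestronglyMeasurable
  have h1 : eLpNorm (fderiv ℝ (cutoffSq r φ)) 1 volume ≤ eLpNorm ((fun x => ‖2 * φ x‖) •
      fun x => ‖ψ₀ x‖ + ‖ψ₁ x‖ + ‖((c * r : ℝ) : ℂ) * φ x‖) 1 (volume : Measure Plane) :=
    eLpNorm_mono_real fun x => norm_fderiv_cutoffSq_le hc hr.le φ x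
  refine h1.trans ((eLpNorm_smul_le_mul_eLpNorm (p := 2) (q := 2) (((m ψ₀).add (m ψ₁)).add mφ)
    (continuous_const.mul φ.continuous).norm.aestronglyMeasurable).trans ?_)
  rw [ENNReal.ofReal_mul (by positivity)]
  refine mul_le_mul' ?_ ?_
  · rw [eLpNorm_norm, toL2_ofSchwartz, ENNReal.ofReal_mul (by norm_num), ← eLpNorm_schwartz]
    refine (eLpNorm_const_smul_le (c := (2 : ℂ)) (f := φ)).trans ?_
    rw [← ofReal_norm]
    simp
  · refine (eLpNorm_add_le ((m ψ₀).add (m ψ₁)) mφ (by norm_num)).trans ?_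
    rw [ENNReal.ofReal_add (by positivity) (by positivity)]
    refine add_le_add ((eLpNorm_add_le (m ψ₀) (m ψ₁) (by norm_num)).trans ?_) ?_
    · rw [ENNReal.ofReal_add (by positivity) (by positivity), eLpNorm_norm, eLpNorm_norm,
        eLpNorm_schwartz, eLpNorm_schwartz]
      rfl
    · rw [eLpNorm_norm, toL2_ofSchwartz, ENNReal.ofReal_mul (by positivity), ← eLpNorm_schwartz]
      refine (eLpNorm_const_smul_le (c := ((c * r : ℝ) : ℂ)) (f := φ)).trans ?_
      rw [← ofReal_norm, Complex.norm_real, Real.norm_of_nonneg (by positivity)]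

theorem tendsto_cutoff (x : Plane) {r : ℕ → ℝ} (hr : Tendsto r atTop (𝓝 0)) :
    ∀ᶠ n in atTop, cutoff (r n • x) = 1 := by
  have h : Tendsto (fun n => r n • x) atTop (𝓝 0) := by simpa using hr.smul_const x
  filter_upwards [h.eventually (Metric.closedBall_mem_nhds 0 one_pos)] with n hn
  exact cutoff.one_of_mem_closedBall hn

/-- Approximate by Schwartz functions, cut off at radii growing to infinity, and apply Fatou along
an almost everywhere convergent subsequence. The cutoff term vanishes in the limit, which leaves the
scale-invariant product. -/
theorem eLpNorm_sq_le {c : ℝ} (hc : ∀ x, ‖fderiv ℝ cutoff x‖ ≤ c) (u : H1) :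
    eLpNorm (fun x => (toL2 u x) ^ 2) 2 volume ≤
      eLpNormLESNormFDerivOneConst (volume : Measure Plane) (2 : NNReal) *
      ENNReal.ofReal (2 * ‖toL2 u‖ * (‖grad u 0‖ + ‖grad u 1‖)) := by
  obtain ⟨w, hw, hwu⟩ := mem_closure_iff_seq_limit.1 (denseRange_ofSchwartz u)
  choose φ hφ using hw
  obtain rfl : w = fun n => ofSchwartz (φ n) := funext fun n => (hφ n).symm
  have hL : Tendsto (fun n => toL2 (ofSchwartz (φ n))) atTop (𝓝 (toL2 u)) :=
    (toL2CLM.continuous.tendsto u).comp hwu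
  have hG : ∀ i, Tendsto (fun n => grad (ofSchwartz (φ n)) i) atTop (𝓝 (grad u i)) := fun i =>
    ((gradCLM i).continuous.tendsto u).comp hwu
  obtain ⟨ns, hns, hae⟩ := (tendstoInMeasure_of_tendsto_Lp hL).exists_seq_tendsto_ae
  have hr : Tendsto (fun k : ℕ => 1 / ((k : ℝ) + 1)) atTop (𝓝 0) :=
    tendsto_one_div_add_atTop_nhds_zero_nat
  have hlim : ∀ᵐ x, Tendsto (fun k : ℕ => cutoffSq (1 / ((k : ℝ) + 1)) (φ (ns k)) x) atTop
      (𝓝 ((toL2 u x) ^ 2)) := by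
    have h2 : ∀ᵐ x, ∀ k, toL2 (ofSchwartz (φ (ns k))) x = φ (ns k) x :=
      ae_all_iff.2 fun k => (φ (ns k)).coeFn_toLp 2 volume
    filter_upwards [hae, h2] with x hx hx2
    refine (hx.pow 2).congr' ?_
    filter_upwards [tendsto_cutoff x hr] with k hk
    rw [cutoffSq, hk, hx2 k]
    simp
  have hF := Lp.eLpNorm_lim_le_liminf_eLpNorm (p := 2)
    (fun k => (contDiff_cutoffSq (1 / ((k : ℝ) + 1)) (φ (ns k))).continuous.aestronglyMeasurable)
    _ hlim
  refine hF.trans ?_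
  have hT : Tendsto (fun k : ℕ =>
      (eLpNormLESNormFDerivOneConst (volume : Measure Plane) (2 : NNReal) : ℝ≥0∞) *
      ENNReal.ofReal (2 * ‖toL2 (ofSchwartz (φ (ns k)))‖ * (‖grad (ofSchwartz (φ (ns k))) 0‖
        + ‖grad (ofSchwartz (φ (ns k))) 1‖
        + c * (1 / ((k : ℝ) + 1)) * ‖toL2 (ofSchwartz (φ (ns k)))‖))) atTop
      (𝓝 (eLpNormLESNormFDerivOneConst (volume : Measure Plane) (2 : NNReal) *
      ENNReal.ofReal (2 * ‖toL2 u‖ * (‖grad u 0‖ + ‖grad u 1‖ + c * 0 * ‖toL2 u‖)))) := by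
    refine ENNReal.Tendsto.const_mul (ENNReal.tendsto_ofReal ?_) (Or.inr ENNReal.coe_ne_top)
    have a := (hL.comp hns.tendsto_atTop).norm
    have b := fun i => ((hG i).comp hns.tendsto_atTop).norm
    exact (a.const_mul 2).mul (((b 0).add (b 1)).add ((hr.const_mul c).mul a))
  rw [mul_zero, zero_mul, add_zero] at hT
  rw [← hT.liminf_eq]
  exact liminf_le_liminf (Eventually.of_forall fun k =>
    eLpNorm_cutoffSq_le hc (by positivity) (φ (ns k)))

/-- The Sobolev embedding `H¹(ℝ²) ⊂ L⁴(ℝ²)`. -/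
theorem memLp_norm_sq (u : H1) :
    MemLp (fun x => ((‖toL2 u x‖ ^ 2 : ℝ) : ℂ)) 2 (volume : Measure Plane) := by
  obtain ⟨c, -, hc⟩ := exists_norm_fderiv_cutoff_le
  have hm : AEStronglyMeasurable (toL2 u) (volume : Measure Plane) := Lp.aestronglyMeasurable _
  refine ⟨Complex.continuous_ofReal.comp_aestronglyMeasurable (hm.norm.pow 2), ?_⟩
  have e : eLpNorm (fun x => ((‖toL2 u x‖ ^ 2 : ℝ) : ℂ)) 2 (volume : Measure Plane)
      = eLpNorm (fun x => (toL2 u x) ^ 2) 2 volume := eLpNorm_congr_norm_ae (by simp)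
  rw [e]
  exact (eLpNorm_sq_le hc u).trans_lt (ENNReal.mul_lt_top ENNReal.coe_lt_top ENNReal.ofReal_lt_top)

theorem normSq_toL2 (u : H1) : normSq (toL2 u) = (memLp_norm_sq u).toLp _ := by
  rw [normSq, dif_pos (memLp_norm_sq u)]

theorem coeFn_normSq (u : H1) :
    normSq (toL2 u) =ᵐ[volume] fun x => ((‖toL2 u x‖ ^ 2 : ℝ) : ℂ) := by
  rw [normSq_toL2]
  exact MemLp.coeFn_toLp _

/-- The Gagliardo–Nirenberg inequality `‖u‖₄² ≤ C ‖∇u‖₂ ‖u‖₂`. -/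
theorem exists_norm_normSq_le :
    ∃ C, 0 < C ∧ ∀ u : H1, ‖normSq (toL2 u)‖ ≤ C * ‖grad u‖ * ‖toL2 u‖ := by
  obtain ⟨c, -, hc⟩ := exists_norm_fderiv_cutoff_le
  set K : ℝ := (eLpNormLESNormFDerivOneConst (volume : Measure Plane) (2 : NNReal) : ℝ) with hK
  have hK0 : 0 ≤ K := NNReal.coe_nonneg _
  -- Each of the two partials is at most ‖∇u‖, which gives 4K; the extra 1 makes the constant
  -- positive.
  refine ⟨4 * K + 1, by positivity, fun u => ?_⟩
  have e : eLpNorm (fun x => ((‖toL2 u x‖ ^ 2 : ℝ) : ℂ)) 2 (volume : Measure Plane)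
      = eLpNorm (fun x => (toL2 u x) ^ 2) 2 volume := eLpNorm_congr_norm_ae (by simp)
  have h1 : ‖normSq (toL2 u)‖ ≤ K * (2 * ‖toL2 u‖ * (‖grad u 0‖ + ‖grad u 1‖)) := by
    rw [normSq_toL2, Lp.norm_toLp, e]
    refine ENNReal.toReal_le_of_le_ofReal (by positivity) ?_
    rw [ENNReal.ofReal_mul hK0, hK, ENNReal.ofReal_coe_nnreal]
    exact eLpNorm_sq_le hc u
  have h2 : ∀ i, ‖grad u i‖ ≤ ‖grad u‖ := fun i => PiLp.norm_apply_le (grad u) i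
  have h3 : K * (2 * ‖toL2 u‖ * (‖grad u 0‖ + ‖grad u 1‖))
      ≤ K * (2 * ‖toL2 u‖ * (‖grad u‖ + ‖grad u‖)) := by
    gcongr <;> exact h2 _
  have h4 : 0 ≤ ‖grad u‖ * ‖toL2 u‖ := by positivity
  nlinarith

/-! ### Projection onto low frequencies -/

/-- The indicator function of the ball of radius `N`, as the symbol of a Fourier multiplier. -/
def lowPass (N : ℝ) : Lp ℂ ∞ (volume : Measure Plane) :=
  (MemLp.indicator (s := Metric.ball (0 : Plane) N) measurableSet_ball
    (memLp_top_const (1 : ℂ))).toLp _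

theorem coeFn_lowPass (N : ℝ) :
    lowPass N =ᵐ[volume] (Metric.ball (0 : Plane) N).indicator fun _ => (1 : ℂ) :=
  MemLp.coeFn_toLp _

/-- The projection of an element of `H¹` onto the frequencies below `N`. -/
def lowProj (N : ℝ) (u : H1) : H1 :=
  ofWeakPartial _ _ fun i => IsWeakPartial.fourierMul (u.2 i) (lowPass N)

theorem toL2_lowProj (N : ℝ) (u : H1) : toL2 (lowProj N u) = fourierMul (lowPass N) (toL2 u) := rfl

theorem fourier_sub (f g : L2) : (𝓕 (f - g) : L2) = 𝓕 f - 𝓕 g :=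
  (Lp.fourierTransformₗᵢ Plane ℂ).map_sub f g

theorem coeFn_fourier_sub_fourierMul_lowPass (N : ℝ) (f : L2) :
    (𝓕 (f - fourierMul (lowPass N) f) : L2) =ᵐ[volume]
      (Metric.ball (0 : Plane) N)ᶜ.indicator (𝓕 f : L2) := by
  rw [fourier_sub]
  filter_upwards [Lp.coeFn_sub (𝓕 f : L2) (𝓕 (fourierMul (lowPass N) f) : L2),
    coeFn_fourier_fourierMul (lowPass N) f, coeFn_lowPass N] with ξ h1 h2 h3
  rw [h1, Pi.sub_apply, h2, h3]
  by_cases h : ξ ∈ Metric.ball (0 : Plane) N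
  · rw [Set.indicator_of_mem h, Set.indicator_of_notMem (Set.notMem_compl_iff.2 h)]
    simp
  · rw [Set.indicator_of_notMem h, Set.indicator_of_mem (Set.mem_compl h)]
    simp

theorem norm_sub_fourierMul_lowPass_le (N : ℝ) (f : L2) :
    ‖f - fourierMul (lowPass N) f‖ ≤ ‖f‖ := by
  rw [← Lp.norm_fourier_eq, ← Lp.norm_fourier_eq f]
  apply Lp.norm_le_norm_of_ae_le
  filter_upwards [coeFn_fourier_sub_fourierMul_lowPass N f] with ξ hξ
  rw [hξ]
  exact norm_indicator_le_norm_self _ _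

theorem norm_fourierMul_lowPass_le (N : ℝ) (f : L2) : ‖fourierMul (lowPass N) f‖ ≤ ‖f‖ := by
  rw [← Lp.norm_fourier_eq, ← Lp.norm_fourier_eq f]
  apply Lp.norm_le_norm_of_ae_le
  filter_upwards [coeFn_fourier_fourierMul (lowPass N) f, coeFn_lowPass N] with ξ hξ h2
  rw [hξ, norm_mul, h2]
  refine mul_le_of_le_one_left (norm_nonneg _) ?_
  exact (norm_indicator_le_norm_self _ _).trans (by simp)

theorem norm_grad_sub_lowProj_le (N : ℝ) (u : H1) : ‖grad (u - lowProj N u)‖ ≤ ‖grad u‖ := by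
  apply le_of_sq_le_sq _ (norm_nonneg _)
  have h : ∀ i, grad (u - lowProj N u) i = grad u i - fourierMul (lowPass N) (grad u i) :=
    fun i => map_sub (gradCLM i) u (lowProj N u)
  rw [norm_grad_sq, norm_grad_sq, h, h]
  gcongr <;> exact norm_sub_fourierMul_lowPass_le N _

theorem abs_le_norm_derivSymbol (i : Fin 2) (ξ : Plane) : |ξ i| ≤ ‖derivSymbol i ξ‖ := by
  unfold derivSymbol
  simp only [norm_mul, Complex.norm_ofNat, Complex.norm_real, Complex.norm_I, mul_one,
    Real.norm_eq_abs, abs_of_pos Real.pi_pos]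
  nlinarith [Real.pi_gt_three, abs_nonneg (ξ i)]

/-- By Plancherel: the high-frequency part lives on N ≤ |ξ|, and |ξ|² is at most the sum of the
squared derivative symbols. -/
theorem norm_toL2_sub_lowProj_le {N : ℝ} (hN : 0 < N) (u : H1) :
    N * ‖toL2 (u - lowProj N u)‖ ≤ ‖grad u‖ := by
  apply le_of_sq_le_sq _ (norm_nonneg _)
  rw [toL2_sub, toL2_lowProj, mul_pow, ← Lp.norm_fourier_eq, norm_sq_eq_integral, norm_grad_sq,
    ← Lp.norm_fourier_eq (grad u 0), ← Lp.norm_fourier_eq (grad u 1),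
    norm_sq_eq_integral (𝓕 (grad u 0) : L2), norm_sq_eq_integral (𝓕 (grad u 1) : L2),
    ← integral_const_mul, ← integral_add (integrable_norm_sq _) (integrable_norm_sq _)]
  refine integral_mono_ae ((integrable_norm_sq _).const_mul _)
    ((integrable_norm_sq _).add (integrable_norm_sq _)) ?_
  filter_upwards [coeFn_fourier_sub_fourierMul_lowPass N (toL2 u), coeFn_fourier_grad u 0,
    coeFn_fourier_grad u 1] with ξ h1 h2 h3
  simp only [h1, h2, h3, norm_mul, mul_pow]
  by_cases h : ξ ∈ Metric.ball (0 : Plane) N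
  · rw [Set.indicator_of_notMem (Set.notMem_compl_iff.2 h)]
    rw [norm_zero, zero_pow two_ne_zero, mul_zero]
    positivity
  · rw [Set.indicator_of_mem (Set.mem_compl h), ← add_mul]
    refine mul_le_mul_of_nonneg_right ?_ (by positivity)
    have h4 : N ≤ ‖ξ‖ := by simpa using h
    have h5 : ‖ξ‖ ^ 2 = ξ 0 ^ 2 + ξ 1 ^ 2 := by
      rw [EuclideanSpace.real_norm_sq_eq, Fin.sum_univ_two]
    have h6 := fun i => pow_le_pow_left₀ (abs_nonneg _) (abs_le_norm_derivSymbol i ξ) 2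
    simp only [sq_abs] at h6
    nlinarith [h6 0, h6 1]

/-- The convolution kernel of the projection onto low frequencies. -/
def lowKernel (N : ℝ) : L2 :=
  𝓕⁻ (indicatorConstLp 2 (measurableSet_ball (x := (0 : Plane)) (ε := N))
    measure_ball_lt_top.ne (1 : ℂ) : L2)

theorem inner_lowKernel (N : ℝ) (f : L2) :
    inner ℂ (lowKernel N) f = ∫ ξ in Metric.ball (0 : Plane) N, (𝓕 f : L2) ξ := by
  rw [← Lp.inner_fourier_eq, lowKernel, fourier_fourierInv_eq, L2.inner_indicatorConstLp_one]

theorem inner_shift_right (a : Plane) (f g : L2) :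
    inner ℂ f (shift a g) = inner ℂ (shift (-a) f) g := by
  have h := LinearIsometry.inner_map_map (𝕜 := ℂ) (E := L2) (E' := L2)
    ⟨⟨⟨shift a, shift_add a⟩, shift_smul a⟩, norm_shift a⟩ (shift (-a) f) g
  have e : shift a (shift (-a) f) = f := by rw [shift_shift, add_neg_cancel, shift_zero]
  change inner ℂ (shift a (shift (-a) f)) (shift a g) = _ at h
  rwa [e] at h

theorem inner_lowKernel_shift (N : ℝ) (f : L2) (y : Plane) :
    inner ℂ (lowKernel N) (shift y f)
      = 𝓕⁻ ((Metric.ball (0 : Plane) N).indicator (𝓕 f : L2)) y := by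
  rw [inner_lowKernel, Real.fourierInv_eq, ← integral_indicator measurableSet_ball]
  apply integral_congr_ae
  filter_upwards [coeFn_fourier_shift y f] with ξ hξ
  by_cases h : ξ ∈ Metric.ball (0 : Plane) N
  · rw [Set.indicator_of_mem h, Set.indicator_of_mem h, hξ, character, Circle.smul_def,
      real_inner_comm, smul_eq_mul]
  · rw [Set.indicator_of_notMem h, Set.indicator_of_notMem h, smul_zero]

theorem integrable_indicator_ball (N : ℝ) (f : L2) :
    Integrable ((Metric.ball (0 : Plane) N).indicator f) (volume : Measure Plane) := by
  rw [integrable_indicator_iff measurableSet_ball]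
  have : IsFiniteMeasure ((volume : Measure Plane).restrict (Metric.ball 0 N)) :=
    ⟨by rw [Measure.restrict_apply_univ]; exact measure_ball_lt_top⟩
  exact ((Lp.memLp f).restrict _).integrable (q := 2) (by norm_num)

/-- The projection onto low frequencies is given by pairing with a kernel. -/
theorem coeFn_fourierMul_lowPass (N : ℝ) (f : L2) :
    fourierMul (lowPass N) f =ᵐ[volume] fun y => inner ℂ (lowKernel N) (shift y f) := by
  have hcont : Continuous fun y => inner ℂ (lowKernel N) (shift y f) :=
    continuous_const.inner (continuous_shift_left f)
  refine ae_eq_of_integral_schwartz_smul_eq (locallyIntegrable_coe _)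
    hcont.locallyIntegrable fun φ => ?_
  rw [← Lp.toTemperedDistribution_apply, fourierMul, ← Lp.fourierInv_toTemperedDistribution_eq,
    TemperedDistribution.fourierInv_apply, Lp.toTemperedDistribution_apply]
  simp only [inner_lowKernel_shift]
  have hL : Continuous fun p : Plane × Plane => (-innerₗ Plane) p.1 p.2 := by
    simp only [LinearMap.neg_apply, innerₗ_apply_apply]
    fun_prop
  -- The multiplication formula, for the form −⟨·,·⟩ so that it concerns the inverse transform; the
  -- form is symmetric, so the flip changes nothing.
  have h := VectorFourier.integral_fourierIntegral_smul_eq_flip (L := -innerₗ Plane)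
    (μ := (volume : Measure Plane)) (ν := (volume : Measure Plane)) Real.continuous_fourierChar
    hL φ.integrable
    (integrable_indicator_ball N (𝓕 f : L2))
  have e : (-innerₗ Plane).flip = -innerₗ Plane := by
    ext x y; simp [real_inner_comm]
  rw [e] at h
  refine Eq.trans ?_ h
  apply integral_congr_ae
  filter_upwards [Lp.coeFn_lpSMul (r := 2) (lowPass N) (𝓕 f : L2), coeFn_lowPass N] with ξ h1 h2
  rw [h1, Pi.smul_apply', h2, SchwartzMap.fourierInv_coe]
  change 𝓕⁻ (⇑φ) ξ • _ = 𝓕⁻ (⇑φ) ξ • _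
  by_cases h : ξ ∈ Metric.ball (0 : Plane) N
  · rw [Set.indicator_of_mem h, Set.indicator_of_mem h, one_smul]
  · rw [Set.indicator_of_notMem h, Set.indicator_of_notMem h, zero_smul]

/-- If the low frequencies of `u` are uniformly small, then so is `‖u‖₄`, up to the contribution
of the high frequencies. -/
theorem norm_normSq_le_of_lowKernel_le {C : ℝ} (hC : 0 < C)
    (hGN : ∀ u : H1, ‖normSq (toL2 u)‖ ≤ C * ‖grad u‖ * ‖toL2 u‖) {N S : ℝ} (hN : 0 < N)
    (u : H1) (hS : ∀ y, ‖inner ℂ (lowKernel N) (shift y (toL2 u))‖ ≤ S) :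
    ‖normSq (toL2 u)‖ ≤ 2 * S * ‖toL2 u‖ + 2 * (C * ‖grad u‖ ^ 2 / N) := by
  have hS0 : 0 ≤ S := (norm_nonneg _).trans (hS 0)
  set r := u - lowProj N u with hr
  -- Pointwise |u|² ≤ 2|p|² + 2|r|² for the low part p and the high part r, and one factor |p| is at
  -- most `S`.
  have h1 : ‖normSq (toL2 u)‖
      ≤ 2 * S * ‖fourierMul (lowPass N) (toL2 u)‖ + 2 * ‖normSq (toL2 r)‖ := by
    apply norm_le_add_of_ae_le (by positivity) (by norm_num)
    have h2 : toL2 r = toL2 u - fourierMul (lowPass N) (toL2 u) := toL2_sub _ _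
    filter_upwards [coeFn_normSq u, coeFn_normSq r, coeFn_fourierMul_lowPass N (toL2 u),
      Lp.coeFn_sub (toL2 u) (fourierMul (lowPass N) (toL2 u))] with x h3 h4 h5 h6
    rw [h2, h6] at h4
    rw [h3, h2, h4, Complex.norm_real, Complex.norm_real, Real.norm_of_nonneg (by positivity),
      Real.norm_of_nonneg (by positivity), Pi.sub_apply]
    have h7 := hS x
    rw [← h5] at h7
    set a := toL2 u x
    set p := (fourierMul (lowPass N) (toL2 u)) x
    have h8 : ‖a‖ ≤ ‖p‖ + ‖a - p‖ := by simpa using norm_add_le p (a - p)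
    have h9 := pow_le_pow_left₀ (norm_nonneg _) h8 2
    have h10 := mul_le_mul_of_nonneg_right h7 (norm_nonneg p)
    nlinarith [sq_nonneg (‖p‖ - ‖a - p‖)]
  have h2 : ‖normSq (toL2 r)‖ ≤ C * ‖grad u‖ ^ 2 / N := by
    refine (hGN r).trans ?_
    rw [le_div_iff₀ hN]
    have h3 := norm_toL2_sub_lowProj_le hN u
    have h4 := norm_grad_sub_lowProj_le N u
    calc C * ‖grad r‖ * ‖toL2 r‖ * N = C * (‖grad r‖ * (N * ‖toL2 r‖)) := by ring
      _ ≤ C * (‖grad u‖ * ‖grad u‖) := by gcongr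
      _ = C * ‖grad u‖ ^ 2 := by ring
  have h3 := norm_fourierMul_lowPass_le N (toL2 u)
  calc _ ≤ _ := h1
    _ ≤ _ := by gcongr

/-! ### Local compactness -/

/-- Local Rellich compactness. -/
theorem tendsto_setIntegral_norm_sq {w : ℕ → H1} {B : ℝ} (hB : ∀ n, ‖w n‖ ≤ B)
    (hw : ∀ f : L2, Tendsto (fun n => inner ℂ f (toL2 (w n))) atTop (𝓝 0)) {S : Set Plane}
    (hS : volume S < ∞) :
    Tendsto (fun n => ∫ x in S, ‖toL2 (w n) x‖ ^ 2) atTop (𝓝 0) := by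
  have hB0 : 0 ≤ B := (norm_nonneg _).trans (hB 0)
  have hfin : IsFiniteMeasure ((volume : Measure Plane).restrict S) :=
    ⟨by rwa [Measure.restrict_apply_univ]⟩
  -- At a fixed point the low-frequency part is a pairing with a fixed shifted kernel, so it tends
  -- to 0; it is dominated by a constant, which is integrable on `S`.
  have hlow : ∀ N : ℝ, Tendsto (fun n => ∫ y in S,
      ‖inner ℂ (lowKernel N) (shift y (toL2 (w n)))‖ ^ 2) atTop (𝓝 0) := by
    intro N
    rw [← integral_zero Plane ℝ (μ := volume.restrict S)]
    refine tendsto_integral_of_dominated_convergence (fun _ => (‖lowKernel N‖ * B) ^ 2)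
      (fun n => ?_) (integrable_const _) (fun n => ?_) ?_
    · exact ((continuous_const.inner (continuous_shift_left _)).norm.pow 2).aestronglyMeasurable
    · refine Eventually.of_forall fun y => ?_
      rw [Real.norm_of_nonneg (by positivity)]
      gcongr
      refine (norm_inner_le_norm _ _).trans ?_
      rw [norm_shift]
      gcongr
      exact (norm_toL2_le _).trans (hB n)
    · refine Eventually.of_forall fun y => ?_
      simp only [inner_shift_right]
      simpa using (hw (shift (-y) (lowKernel N))).norm.pow 2
  -- The high-frequency part is O(1/N) in `L²`, uniformly in `n`.
  have hbound : ∀ N : ℝ, 0 < N → ∀ n, ∫ x in S, ‖toL2 (w n) x‖ ^ 2 ≤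
      2 * (∫ y in S, ‖inner ℂ (lowKernel N) (shift y (toL2 (w n)))‖ ^ 2) + 2 * (B / N) ^ 2 := by
    intro N hN n
    set p := fourierMul (lowPass N) (toL2 (w n)) with hp
    have e : ∫ y in S, ‖inner ℂ (lowKernel N) (shift y (toL2 (w n)))‖ ^ 2
        = ∫ y in S, ‖p y‖ ^ 2 := by
      apply integral_congr_ae
      filter_upwards [ae_restrict_of_ae (coeFn_fourierMul_lowPass N (toL2 (w n)))] with y hy
      rw [hy]
    have h1 : ∫ x in S, ‖(toL2 (w n) - p) x‖ ^ 2 ≤ (B / N) ^ 2 := by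
      have h2 : ∫ x in S, ‖(toL2 (w n) - p) x‖ ^ 2 ≤ ‖toL2 (w n) - p‖ ^ 2 := by
        rw [norm_sq_eq_integral]
        exact setIntegral_le_integral (integrable_norm_sq _)
          (Eventually.of_forall fun x => by positivity)
      refine h2.trans (pow_le_pow_left₀ (norm_nonneg _) ?_ 2)
      rw [le_div_iff₀ hN, mul_comm]
      have h3 := norm_toL2_sub_lowProj_le hN (w n)
      rw [toL2_sub, toL2_lowProj] at h3
      exact h3.trans ((norm_grad_le _).trans (hB n))
    have h4 : ∫ x in S, ‖toL2 (w n) x‖ ^ 2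
        ≤ ∫ x in S, (2 * ‖p x‖ ^ 2 + 2 * ‖(toL2 (w n) - p) x‖ ^ 2) := by
      refine integral_mono_ae (integrable_norm_sq _).integrableOn
        (((integrable_norm_sq _).const_mul 2).add
          ((integrable_norm_sq _).const_mul 2)).integrableOn ?_
      filter_upwards [ae_restrict_of_ae (Lp.coeFn_sub (toL2 (w n)) p)] with x hx
      simp only [hx, Pi.sub_apply]
      have h8 : ‖toL2 (w n) x‖ ≤ ‖p x‖ + ‖toL2 (w n) x - p x‖ := by
        simpa using norm_add_le (p x) (toL2 (w n) x - p x)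
      nlinarith [sq_nonneg (‖p x‖ - ‖toL2 (w n) x - p x‖),
        pow_le_pow_left₀ (norm_nonneg _) h8 2]
    rw [integral_add ((integrable_norm_sq _).const_mul 2).integrableOn
      ((integrable_norm_sq _).const_mul 2).integrableOn, integral_const_mul,
      integral_const_mul] at h4
    rw [e]
    linarith
  refine tendsto_order.2 ⟨fun a ha => Eventually.of_forall fun n => ha.trans_le
    (integral_nonneg fun x => by positivity), fun a ha => ?_⟩
  obtain ⟨N, hN, hNa⟩ : ∃ N : ℝ, 0 < N ∧ 2 * (B / N) ^ 2 < a := by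
    have h1 : Tendsto (fun N : ℝ => 2 * (B / N) ^ 2) atTop (𝓝 (2 * 0 ^ 2)) :=
      ((tendsto_const_nhds.div_atTop tendsto_id).pow 2).const_mul 2
    have h2 : (2 * 0 ^ 2 : ℝ) < a := by simpa using ha
    obtain ⟨N, h3, h4⟩ := ((h1.eventually_lt_const h2).and (eventually_gt_atTop 0)).exists
    exact ⟨N, h4, h3⟩
  have h5 := ((hlow N).const_mul 2).add_const (2 * (B / N) ^ 2)
  have h6 : 2 * 0 + 2 * (B / N) ^ 2 < a := by simpa using hNa
  filter_upwards [h5.eventually_lt_const h6] with n hn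
  exact (hbound N hN n).trans_lt hn

theorem isClosed_setOf_tendsto_inner {E : Type*} [NormedAddCommGroup E] [InnerProductSpace ℂ E]
    {b : ℕ → E} {K : ℝ} (hb : ∀ n, ‖b n‖ ≤ K) :
    IsClosed {f : E | Tendsto (fun n => inner ℂ f (b n)) atTop (𝓝 0)} := by
  have hK : 0 ≤ K := (norm_nonneg _).trans (hb 0)
  refine isClosed_of_closure_subset fun f hf => ?_
  refine Metric.tendsto_nhds.2 fun ε hε => ?_
  obtain ⟨g, hg, hfg⟩ := Metric.mem_closure_iff.1 hf (ε / (2 * (K + 1))) (by positivity)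
  filter_upwards [Metric.tendsto_nhds.1 hg (ε / 2) (by positivity)] with n hn
  rw [dist_zero_right] at hn ⊢
  have h1 : inner ℂ f (b n) = inner ℂ (f - g) (b n) + inner ℂ g (b n) := by
    rw [inner_sub_left]; ring
  have h2 : ‖inner ℂ (f - g) (b n)‖ ≤ ε / 2 := by
    refine (norm_inner_le_norm _ _).trans ?_
    rw [← dist_eq_norm]
    calc dist f g * ‖b n‖ ≤ ε / (2 * (K + 1)) * (K + 1) := by
          gcongr
          exact (hb n).trans (by linarith)
      _ = ε / 2 := by field_simp
  rw [h1]
  refine (norm_add_le _ _).trans_lt ?_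
  linarith

/-- The squares are bounded in `L²`, so it suffices to test with simple functions; there the claim
is local compactness on sets of finite measure. -/
theorem tendsto_inner_normSq {w : ℕ → H1} {B : ℝ} (hB : ∀ n, ‖w n‖ ≤ B)
    (hw : ∀ f : L2, Tendsto (fun n => inner ℂ f (toL2 (w n))) atTop (𝓝 0)) (f : L2) :
    Tendsto (fun n => inner ℂ f (normSq (toL2 (w n)))) atTop (𝓝 0) := by
  obtain ⟨C, hC, hGN⟩ := exists_norm_normSq_le
  have hb : ∀ n, ‖normSq (toL2 (w n))‖ ≤ C * B * B := fun n => by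
    have hB0 : 0 ≤ B := (norm_nonneg _).trans (hB 0)
    refine (hGN _).trans ?_
    gcongr
    · exact (norm_grad_le _).trans (hB n)
    · exact (norm_toL2_le _).trans (hB n)
  refine Lp.induction (p := 2) (by norm_num)
    (motive := fun f : L2 => Tendsto (fun n => inner ℂ f (normSq (toL2 (w n)))) atTop (𝓝 0))
    (fun c s hs hμs => ?_) (fun f g hf hg _ h1 h2 => ?_) (isClosed_setOf_tendsto_inner hb) f
  · rw [Lp.simpleFunc.coe_indicatorConst]
    simp only [L2.inner_indicatorConstLp_eq_inner_setIntegral]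
    have h1 := tendsto_setIntegral_norm_sq hB hw hμs
    have h2 : ∀ n, ∫ x in s, normSq (toL2 (w n)) x
        = ((∫ x in s, ‖toL2 (w n) x‖ ^ 2 : ℝ) : ℂ) := fun n => by
      rw [← integral_complex_ofReal]
      exact integral_congr_ae (ae_restrict_of_ae (coeFn_normSq (w n)))
    simp only [h2]
    have h3 := (Complex.continuous_ofReal.tendsto 0).comp h1
    simpa using h3.mul_const (starRingEnd ℂ c)
  · simp only [inner_add_left]
    simpa using h1.add h2

/-! ### Weak convergence in `H¹` -/

theorem weaklyConverges_iff {w : ℕ → H1} {V : H1} : WeaklyConverges w V ↔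
    ∀ ψ : H1, Tendsto (fun k => inner ℂ ψ (w k)) atTop (𝓝 (inner ℂ ψ V)) := by
  constructor
  · intro h ψ
    exact h (innerSL ℂ ψ)
  · intro h ℓ
    have e : ∀ u, ℓ u = inner ℂ ((InnerProductSpace.toDual ℂ H1).symm ℓ) u := fun u =>
      (InnerProductSpace.toDual_symm_apply (𝕜 := ℂ) (E := H1)).symm
    simp only [e]
    exact h _

theorem WeaklyConverges.inner_toL2 {w : ℕ → H1} {V : H1} (h : WeaklyConverges w V) (f : L2) :
    Tendsto (fun k => inner ℂ f (toL2 (w k))) atTop (𝓝 (inner ℂ f (toL2 V))) :=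
  h ((innerSL ℂ f).comp toL2CLM)

/-- The gradient as an operator on `H¹`. -/
def gradL : H1 →L[ℂ] PiLp 2 (fun _ : Fin 2 => L2) :=
  (WithLp.sndL 2 ℂ L2 (PiLp 2 fun _ : Fin 2 => L2)).comp sobolevSubmodule.subtypeL

theorem WeaklyConverges.inner_grad {w : ℕ → H1} {V : H1} (h : WeaklyConverges w V)
    (f : PiLp 2 (fun _ : Fin 2 => L2)) :
    Tendsto (fun k => inner ℂ f (grad (w k))) atTop (𝓝 (inner ℂ f (grad V))) :=
  h ((innerSL ℂ f).comp gradL)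

theorem WeaklyConverges.comp {w : ℕ → H1} {V : H1} (h : WeaklyConverges w V) {φ : ℕ → ℕ}
    (hφ : StrictMono φ) : WeaklyConverges (fun k => w (φ k)) V :=
  fun ℓ => (h ℓ).comp hφ.tendsto_atTop

theorem WeaklyConverges.sub {w w' : ℕ → H1} {V V' : H1} (h : WeaklyConverges w V)
    (h' : WeaklyConverges w' V') : WeaklyConverges (fun k => w k - w' k) (V - V') := by
  intro ℓ
  simp only [map_sub]
  exact (h ℓ).sub (h' ℓ)

theorem WeaklyConverges.add {w w' : ℕ → H1} {V V' : H1} (h : WeaklyConverges w V)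
    (h' : WeaklyConverges w' V') : WeaklyConverges (fun k => w k + w' k) (V + V') := by
  intro ℓ
  simp only [map_add]
  exact (h ℓ).add (h' ℓ)

theorem WeaklyConverges.unique {w : ℕ → H1} {V V' : H1} (h : WeaklyConverges w V)
    (h' : WeaklyConverges w V') : V = V' := by
  refine ext_inner_left ℂ fun ψ => ?_
  exact tendsto_nhds_unique (weaklyConverges_iff.1 h ψ) (weaklyConverges_iff.1 h' ψ)

theorem weaklyConverges_const (V : H1) : WeaklyConverges (fun _ => V) V :=
  fun _ => tendsto_const_nhds

/-- Weak sequential compactness of bounded sets in a separable Hilbert space. -/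
theorem exists_tendsto_inner_subseq {E : Type*} [NormedAddCommGroup E] [InnerProductSpace ℂ E]
    [CompleteSpace E] [TopologicalSpace.SeparableSpace E] {w : ℕ → E} {B : ℝ}
    (hB : ∀ n, ‖w n‖ ≤ B) : ∃ (V : E) (φ : ℕ → ℕ), StrictMono φ ∧
      ∀ ψ, Tendsto (fun k => inner ℂ ψ (w (φ k))) atTop (𝓝 (inner ℂ ψ V)) := by
  -- Sequential Banach–Alaoglu through the Riesz identification, which is conjugate linear; hence
  -- the conjugation at the end.
  have hc := WeakDual.isSeqCompact_closedBall (𝕜 := ℂ) (E := E) 0 B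
  obtain ⟨T, -, φ, hφ, hT⟩ := hc (x := fun n =>
    StrongDual.toWeakDual (InnerProductSpace.toDual ℂ E (w n))) (fun n => by
      rw [Set.mem_preimage, mem_closedBall_zero_iff]
      exact ((InnerProductSpace.toDual ℂ E).norm_map (w n)).trans_le (hB n))
  refine ⟨(InnerProductSpace.toDual ℂ E).symm (WeakDual.toStrongDual T), φ, hφ, fun ψ => ?_⟩
  have h1 : Tendsto (fun k => inner ℂ (w (φ k)) ψ) atTop (𝓝 (T ψ)) :=
    ((WeakDual.eval_continuous ψ).tendsto T).comp hT
  have h2 : T ψ = inner ℂ ((InnerProductSpace.toDual ℂ E).symm (WeakDual.toStrongDual T)) ψ :=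
    InnerProductSpace.toDual_symm_apply.symm
  rw [h2] at h1
  have h3 := (Complex.continuous_conj.tendsto _).comp h1
  simpa only [Function.comp_def, inner_conj_symm] using h3

/-- Weak sequential compactness of bounded sets in `H¹`. -/
theorem exists_weaklyConverges_subseq {w : ℕ → H1} {B : ℝ} (hB : ∀ n, ‖w n‖ ≤ B) :
    ∃ (V : H1) (φ : ℕ → ℕ), StrictMono φ ∧ WeaklyConverges (fun k => w (φ k)) V := by
  obtain ⟨V, φ, hφ, h⟩ := exists_tendsto_inner_subseq hB
  exact ⟨V, φ, hφ, weaklyConverges_iff.2 h⟩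

/-! ### The quartic functional and its Brezis–Lieb property -/

theorem opB_eq (f : L2) : opB f = fourierMul (memLp_symbolB.toLp symbolB) f := rfl

theorem opL_shift (ν γ : ℝ) (a : Plane) (f : L2) : opL ν γ (shift a f) = shift a (opL ν γ f) := by
  rw [opL, opL, opB_eq, opB_eq, fourierMul_shift, shift_add, shift_smul, shift_smul]

/-- The operator `𝓛` as a bounded operator on `L²`. -/
def opLCLM (ν γ : ℝ) : L2 →L[ℂ] L2 :=
  (ν : ℂ) • ContinuousLinearMap.id ℂ L2 + (γ : ℂ) • LinearMap.mkContinuous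
    { toFun := opB
      map_add' := fourierMul_add _
      map_smul' := fourierMul_smul _ } ‖memLp_symbolB.toLp symbolB‖ (norm_fourierMul_le _)

theorem opLCLM_apply (ν γ : ℝ) (f : L2) : opLCLM ν γ f = opL ν γ f := rfl

/-- Since |u|² is real, conjugation in the inner product is harmless, and the functional becomes a
bounded quadratic form in |u|². -/
theorem quartic_eq (ν γ : ℝ) (u : H1) : quartic ν γ u
    = (inner ℂ (normSq (toL2 u)) (opLCLM ν γ (normSq (toL2 u)))).re := by
  rw [quartic, L2.inner_def, opLCLM_apply]
  congr 1
  apply integral_congr_ae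
  filter_upwards [coeFn_normSq u] with x hx
  rw [RCLike.inner_apply, hx, Complex.conj_ofReal]

theorem abs_quartic_le (ν γ : ℝ) (u : H1) :
    |quartic ν γ u| ≤ ‖opLCLM ν γ‖ * ‖normSq (toL2 u)‖ ^ 2 := by
  rw [quartic_eq]
  calc _ ≤ ‖inner ℂ (normSq (toL2 u)) (opLCLM ν γ (normSq (toL2 u)))‖ := Complex.abs_re_le_norm _
    _ ≤ ‖normSq (toL2 u)‖ * ‖opLCLM ν γ (normSq (toL2 u))‖ := norm_inner_le_norm _ _
    _ ≤ ‖normSq (toL2 u)‖ * (‖opLCLM ν γ‖ * ‖normSq (toL2 u)‖) := by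
      gcongr; exact ContinuousLinearMap.le_opNorm _ _
    _ = _ := by ring

theorem normSq_translate (a : Plane) (u : H1) :
    normSq (toL2 (translate a u)) = shift a (normSq (toL2 u)) := by
  apply Lp.ext
  have h := (measurePreserving_add_right (volume : Measure Plane) a).quasiMeasurePreserving.ae_eq
    (coeFn_normSq u)
  filter_upwards [coeFn_normSq (translate a u), coeFn_shift a (normSq (toL2 u)),
    coeFn_shift a (toL2 u), h] with x h1 h2 h3 h4
  rw [h1, h2, toL2_translate, h3]
  exact h4.symm

theorem quartic_translate (ν γ : ℝ) (a : Plane) (u : H1) :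
    quartic ν γ (translate a u) = quartic ν γ u := by
  rw [quartic_eq, quartic_eq, normSq_translate, opLCLM_apply, opL_shift, inner_shift_right,
    shift_shift, neg_add_cancel, shift_zero, opLCLM_apply]

theorem tendsto_norm_sub_sq {E : Type*} [NormedAddCommGroup E] [InnerProductSpace ℂ E]
    {x : ℕ → E} {V : E} {s : ℝ} (h : Tendsto (fun k => inner ℂ V (x k)) atTop (𝓝 (inner ℂ V V)))
    (hs : Tendsto (fun k => ‖x k‖ ^ 2) atTop (𝓝 s)) :
    Tendsto (fun k => ‖x k - V‖ ^ 2) atTop (𝓝 (s - ‖V‖ ^ 2)) := by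
  have h1 := (RCLike.continuous_re.tendsto _).comp h
  have h2 := (hs.sub (h1.const_mul 2)).add_const (‖V‖ ^ 2)
  rw [inner_self_eq_norm_sq] at h2
  refine (h2.congr fun k => ?_).trans (le_of_eq (by ring_nf))
  rw [@norm_sub_sq ℂ, ← inner_re_symm]
  rfl

/-- With `F k = a + b k + e k`, the error `e` tends to 0 in norm, and the cross terms of `a` and `b`
vanish by weak convergence after passing to the adjoint. Only boundedness of `L` matters, so a
nonlocal operator is allowed. -/
theorem tendsto_inner_clm_sub {E : Type*} [NormedAddCommGroup E] [InnerProductSpace ℂ E]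
    [CompleteSpace E] (L : E →L[ℂ] E) {a : E} {b F : ℕ → E} {K : ℝ} (hb : ∀ k, ‖b k‖ ≤ K)
    (hb' : ∀ f, Tendsto (fun k => inner ℂ f (b k)) atTop (𝓝 0))
    (he : Tendsto (fun k => F k - (a + b k)) atTop (𝓝 0)) :
    Tendsto (fun k => inner ℂ (F k) (L (F k)) - inner ℂ (b k) (L (b k))) atTop
      (𝓝 (inner ℂ a (L a))) := by
  set e : ℕ → E := fun k => F k - (a + b k) with he'
  have hF : ∀ k, F k = (a + b k) + e k := fun k => (add_sub_cancel _ _).symm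
  have hen : Tendsto (fun k => ‖e k‖) atTop (𝓝 0) := by simpa using he.norm
  have h1 : Tendsto (fun k => inner ℂ a (L (b k))) atTop (𝓝 0) := by
    simpa only [ContinuousLinearMap.adjoint_inner_left] using hb' (L.adjoint a)
  have h2 : Tendsto (fun k => inner ℂ (b k) (L a)) atTop (𝓝 0) := by
    have := (Complex.continuous_conj.tendsto _).comp (hb' (L a))
    simpa [Function.comp_def, inner_conj_symm] using this
  have hab : ∀ k, ‖a + b k‖ ≤ ‖a‖ + K := fun k => (norm_add_le _ _).trans (by gcongr; exact hb k)
  have h3 : Tendsto (fun k => inner ℂ (a + b k) (L (e k))) atTop (𝓝 0) := by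
    refine squeeze_zero_norm (a := fun k => (‖a‖ + K) * (‖L‖ * ‖e k‖)) (fun k => ?_) ?_
    · exact (norm_inner_le_norm _ _).trans (mul_le_mul (hab k) (L.le_opNorm _) (norm_nonneg _)
        ((norm_nonneg _).trans (hab k)))
    · simpa using (hen.const_mul ‖L‖).const_mul (‖a‖ + K)
  have h4 : Tendsto (fun k => inner ℂ (e k) (L (a + b k))) atTop (𝓝 0) := by
    refine squeeze_zero_norm (a := fun k => ‖e k‖ * (‖L‖ * (‖a‖ + K))) (fun k => ?_) ?_
    · refine (norm_inner_le_norm _ _).trans ?_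
      gcongr
      refine (L.le_opNorm _).trans ?_
      gcongr
      exact hab k
    · simpa using hen.mul_const (‖L‖ * (‖a‖ + K))
  have h5 : Tendsto (fun k => inner ℂ (e k) (L (e k))) atTop (𝓝 0) := by
    have := he.inner (𝕜 := ℂ) ((L.continuous.tendsto 0).comp he)
    simpa using this
  have h6 := ((((tendsto_const_nhds (x := inner ℂ a (L a))).add h1).add h2).add h3).add (h4.add h5)
  simp only [add_zero] at h6
  refine h6.congr fun k => ?_
  rw [hF k]
  simp only [map_add, inner_add_left, inner_add_right]
  ring

/-- Pointwise the defect is the cross term 2 Re⟨V, u − V⟩, whose square is at most 4|V|²|u − V|².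
For a weakly convergent sequence the right-hand side pairs a fixed function with a weakly null one.
-/
theorem norm_normSq_sub_le (u V : H1) :
    ‖normSq (toL2 u) - (normSq (toL2 V) + normSq (toL2 (u - V)))‖ ^ 2
      ≤ 4 * (inner ℂ (normSq (toL2 V)) (normSq (toL2 (u - V)))).re := by
  rw [norm_sq_eq_integral, L2.inner_def]
  have hre : (∫ x, inner ℂ (normSq (toL2 V) x) (normSq (toL2 (u - V)) x)).re
      = ∫ x, (inner ℂ (normSq (toL2 V) x) (normSq (toL2 (u - V)) x)).re :=
    (integral_re (𝕜 := ℂ) (L2.integrable_inner (𝕜 := ℂ) _ _)).symm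
  rw [hre, ← integral_const_mul]
  have hint := L2.integrable_inner (𝕜 := ℂ) (normSq (toL2 V)) (normSq (toL2 (u - V)))
  refine integral_mono_ae (integrable_norm_sq _) (hint.re.const_mul 4) ?_
  filter_upwards [coeFn_normSq u, coeFn_normSq V, coeFn_normSq (u - V),
    Lp.coeFn_sub (normSq (toL2 u)) (normSq (toL2 V) + normSq (toL2 (u - V))),
    Lp.coeFn_add (normSq (toL2 V)) (normSq (toL2 (u - V))),
    Lp.coeFn_sub (toL2 u) (toL2 V)] with x h1 h2 h3 h4 h5 h6
  rw [← toL2_sub] at h6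
  simp only [h4, h5, Pi.sub_apply, Pi.add_apply, h1, h2, h3, h6, RCLike.inner_apply,
    Complex.conj_ofReal]
  set p := toL2 V x
  set q := toL2 u x
  have e1 : ((‖q - p‖ ^ 2 : ℝ) : ℂ) * ((‖p‖ ^ 2 : ℝ) : ℂ) = ((‖q - p‖ ^ 2 * ‖p‖ ^ 2 : ℝ) : ℂ) := by
    push_cast; ring
  have e2 : ((‖q‖ ^ 2 : ℝ) : ℂ) - (((‖p‖ ^ 2 : ℝ) : ℂ) + ((‖q - p‖ ^ 2 : ℝ) : ℂ))
      = ((‖q‖ ^ 2 - (‖p‖ ^ 2 + ‖q - p‖ ^ 2) : ℝ) : ℂ) := by push_cast; ring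
  rw [e1, e2, Complex.norm_real, Real.norm_eq_abs, sq_abs]
  change _ ≤ 4 * (((‖q - p‖ ^ 2 * ‖p‖ ^ 2 : ℝ) : ℂ)).re
  rw [Complex.ofReal_re]
  have h7 : ‖q‖ ^ 2 = ‖p‖ ^ 2 + 2 * (inner ℂ p (q - p)).re + ‖q - p‖ ^ 2 := by
    have := @norm_add_sq ℂ _ _ _ _ p (q - p)
    rwa [add_sub_cancel] at this
  have h8 : |(inner ℂ p (q - p)).re| ≤ ‖p‖ * ‖q - p‖ :=
    (Complex.abs_re_le_norm _).trans (norm_inner_le_norm _ _)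
  rw [h7]
  have h9 := pow_le_pow_left₀ (abs_nonneg _) h8 2
  rw [sq_abs] at h9
  nlinarith

theorem WeaklyConverges.tendsto_inner_normSq_sub {w : ℕ → H1} {V : H1} {B : ℝ}
    (h : WeaklyConverges w V) (hB : ∀ k, ‖w k‖ ≤ B) (f : L2) :
    Tendsto (fun k => inner ℂ f (normSq (toL2 (w k - V)))) atTop (𝓝 0) := by
  refine tendsto_inner_normSq (B := B + ‖V‖)
    (fun k => (norm_sub_le _ _).trans (by gcongr; exact hB k)) (fun f => ?_) f
  have := (h.sub (weaklyConverges_const V)).inner_toL2 f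
  simpa [sub_self, toL2_zero] using this

/-- The Brezis–Lieb property of the quartic functional. -/
theorem WeaklyConverges.tendsto_quartic_sub {w : ℕ → H1} {V : H1} {B : ℝ}
    (h : WeaklyConverges w V) (hB : ∀ k, ‖w k‖ ≤ B) (ν γ : ℝ) :
    Tendsto (fun k => quartic ν γ (w k) - quartic ν γ (w k - V)) atTop (𝓝 (quartic ν γ V)) := by
  have hw := h.tendsto_inner_normSq_sub hB
  obtain ⟨C, hC, hGN⟩ := exists_norm_normSq_le
  have hb : ∀ k, ‖normSq (toL2 (w k - V))‖ ≤ C * (B + ‖V‖) * (B + ‖V‖) := fun k => by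
    have h1 : ‖w k - V‖ ≤ B + ‖V‖ := (norm_sub_le _ _).trans (by gcongr; exact hB k)
    have h2 : 0 ≤ B + ‖V‖ := (norm_nonneg _).trans h1
    refine (hGN _).trans ?_
    gcongr
    · exact (norm_grad_le _).trans h1
    · exact (norm_toL2_le _).trans h1
  have he : Tendsto (fun k => normSq (toL2 (w k)) - (normSq (toL2 V) + normSq (toL2 (w k - V))))
      atTop (𝓝 0) := by
    rw [tendsto_zero_iff_norm_tendsto_zero]
    have h1 : Tendsto (fun k => 4 * (inner ℂ (normSq (toL2 V)) (normSq (toL2 (w k - V)))).re)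
        atTop (𝓝 0) := by
      simpa using ((Complex.continuous_re.tendsto _).comp (hw (normSq (toL2 V)))).const_mul 4
    have h2 := squeeze_zero (fun k => sq_nonneg _) (fun k => norm_normSq_sub_le (w k) V) h1
    simpa using h2.sqrt
  have h3 := (Complex.continuous_re.tendsto _).comp (tendsto_inner_clm_sub (opLCLM ν γ) hb hw he)
  simpa only [quartic_eq, Function.comp_def, Complex.sub_re] using h3

/-! ### Nonzero weak limits up to translation -/

/-- A bounded sequence on which the quartic functional stays away from zero has a nonzero weak
limit, up to translations. -/
theorem exists_translate_weaklyConverges (ν γ : ℝ) {ε B : ℝ} (hε : 0 < ε) :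
    ∃ δ, 0 < δ ∧ ∀ v : ℕ → H1, (∀ᶠ n in atTop, ‖v n‖ ≤ B ∧ ε ≤ quartic ν γ (v n)) →
      ∃ (φ : ℕ → ℕ) (y : ℕ → Plane) (V : H1), StrictMono φ ∧
        WeaklyConverges (fun k => translate (y k) (v (φ k))) V ∧ δ ≤ ‖toL2 V‖ ^ 2 := by
  obtain ⟨C, hC, hGN⟩ := exists_norm_normSq_le
  set K := ‖opLCLM ν γ‖ + 1 with hK
  have hK0 : 0 < K := by positivity
  set η := √(ε / K) with hη
  have hη0 : 0 < η := Real.sqrt_pos.2 (by positivity)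
  have hηsq : η ^ 2 = ε / K := Real.sq_sqrt (by positivity)
  set D := |B| + 1 with hD
  have hD0 : 0 < D := by positivity
  -- `S` and `N` make the low- and high-frequency terms equal to η/4 each. Then ‖|u|²‖₂ ≤ η/2, which
  -- forces the functional down to ε/4.
  set S := η / (8 * D) with hS
  set N := 8 * C * D ^ 2 / η with hN
  have hS0 : 0 < S := by positivity
  have hN0 : 0 < N := by positivity
  have hy : ∀ u : H1, ‖u‖ ≤ B ∧ ε ≤ quartic ν γ u →
      ∃ y, S < ‖inner ℂ (lowKernel N) (shift y (toL2 u))‖ := by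
    rintro u ⟨hu, hQ⟩
    by_contra! hcon
    have h1 := norm_normSq_le_of_lowKernel_le hC hGN hN0 u hcon
    have huD : ‖u‖ ≤ D := hu.trans ((le_abs_self B).trans (by linarith))
    have h2 : ‖normSq (toL2 u)‖ ≤ η / 2 := by
      refine h1.trans ?_
      calc _ ≤ 2 * S * D + 2 * (C * D ^ 2 / N) := by
            gcongr
            · exact (norm_toL2_le u).trans huD
            · exact (norm_grad_le u).trans huD
        _ = η / 2 := by rw [hS, hN]; field_simp; norm_num
    have h3 : quartic ν γ u ≤ K * (η / 2) ^ 2 := by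
      refine ((le_abs_self _).trans (abs_quartic_le ν γ u)).trans ?_
      gcongr
      linarith
    have h4 : K * (η / 2) ^ 2 = ε / 4 := by
      rw [div_pow, hηsq]; field_simp; norm_num
    linarith
  -- The lower bound `S` on the pairing with the kernel survives the weak limit, and Cauchy–Schwarz
  -- turns it into mass; the 1 keeps the denominator positive.
  refine ⟨(S / (‖lowKernel N‖ + 1)) ^ 2, by positivity, fun v hv => ?_⟩
  obtain ⟨n₀, hn₀⟩ := eventually_atTop.1 hv
  choose y hyS using fun n => hy (v (n + n₀)) (hn₀ (n + n₀) (by omega))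
  obtain ⟨V, φ, hφ, hV⟩ := exists_weaklyConverges_subseq
    (w := fun n => translate (y n) (v (n + n₀))) (B := B) fun n => by
      rw [norm_translate]; exact (hn₀ (n + n₀) (by omega)).1
  refine ⟨fun k => φ k + n₀, fun k => y (φ k), V, fun a b hab => by simpa using hφ hab, hV, ?_⟩
  have h1 : S ≤ ‖inner ℂ (lowKernel N) (toL2 V)‖ :=
    ge_of_tendsto (hV.inner_toL2 (lowKernel N)).norm (Eventually.of_forall fun k => (hyS (φ k)).le)
  have h2 : S ≤ (‖lowKernel N‖ + 1) * ‖toL2 V‖ :=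
    h1.trans ((norm_inner_le_norm _ _).trans (by gcongr; linarith))
  gcongr
  rw [div_le_iff₀ (by positivity)]
  linarith

/-! ### Weak limits of translates and their removal -/

/-- By Plancherel the pairing is an oscillatory integral of a product of two `L²` functions, so the
Riemann–Lebesgue lemma applies. -/
theorem tendsto_inner_shift_cocompact (f g : L2) :
    Tendsto (fun a => inner ℂ f (shift a g)) (cocompact Plane) (𝓝 0) := by
  have h := (tendsto_integral_exp_inner_smul_cocompact
    (fun ξ : Plane => inner ℂ ((𝓕 f : L2) ξ) ((𝓕 g : L2) ξ))).comp
      (Homeomorph.neg Plane).isClosedEmbedding.tendsto_cocompact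
  refine h.congr fun a => ?_
  rw [← Lp.inner_fourier_eq, L2.inner_def]
  apply integral_congr_ae
  filter_upwards [coeFn_fourier_shift a g] with ξ hξ
  rw [hξ, character]
  simp only [RCLike.inner_apply, Homeomorph.coe_neg, inner_neg_right, neg_neg, Circle.smul_def,
    smul_eq_mul, real_inner_comm]
  ring

theorem weaklyConverges_zero_iff {w : ℕ → H1} : WeaklyConverges w 0 ↔
    ∀ ψ : H1, Tendsto (fun k => inner ℂ ψ (w k)) atTop (𝓝 0) := by
  have h : ∀ ψ : H1, inner ℂ ψ (0 : H1) = 0 := inner_zero_right (𝕜 := ℂ) (E := H1)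
  simp only [weaklyConverges_iff, h]

theorem weaklyConverges_translate_of_norm_atTop (V : H1) {y : ℕ → Plane}
    (hy : Tendsto (fun k => ‖y k‖) atTop atTop) :
    WeaklyConverges (fun k => translate (y k) V) 0 := by
  have hy' : Tendsto y atTop (cocompact Plane) := by
    rw [← Metric.cobounded_eq_cocompact]
    exact tendsto_norm_atTop_iff_cobounded.1 hy
  refine weaklyConverges_zero_iff.2 fun ψ => ?_
  have h := fun f g => (tendsto_inner_shift_cocompact f g).comp hy'
  have h1 := (h (toL2 ψ) (toL2 V)).add
    ((h (grad ψ 0) (grad V 0)).add (h (grad ψ 1) (grad V 1)))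
  simp only [add_zero] at h1
  exact h1.congr fun k => (inner_eq _ _).symm

theorem tendsto_inner_zero_of_tendsto {E : Type*} [NormedAddCommGroup E] [InnerProductSpace ℂ E]
    {x r : ℕ → E} {x₀ : E} {B : ℝ} (hx : Tendsto x atTop (𝓝 x₀)) (hB : ∀ k, ‖r k‖ ≤ B)
    (hr : Tendsto (fun k => inner ℂ x₀ (r k)) atTop (𝓝 0)) :
    Tendsto (fun k => inner ℂ (x k) (r k)) atTop (𝓝 0) := by
  have h2 : Tendsto (fun k => inner ℂ (x k - x₀) (r k)) atTop (𝓝 0) := by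
    refine squeeze_zero_norm (a := fun k => ‖x k - x₀‖ * B) (fun k => ?_) ?_
    · exact (norm_inner_le_norm _ _).trans (mul_le_mul_of_nonneg_left (hB k) (norm_nonneg _))
    · simpa using (hx.sub_const x₀).norm.mul_const B
  have h3 := h2.add hr
  rw [add_zero] at h3
  refine h3.congr fun k => ?_
  rw [inner_sub_left]
  ring

/-- The translation is moved to the test function, where it converges in norm. -/
theorem WeaklyConverges.translate_zero {r : ℕ → H1} {B : ℝ} (hr : WeaklyConverges r 0)
    (hB : ∀ k, ‖r k‖ ≤ B) {z : ℕ → Plane} {z₀ : Plane} (hz : Tendsto z atTop (𝓝 z₀)) :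
    WeaklyConverges (fun k => translate (z k) (r k)) 0 := by
  refine weaklyConverges_zero_iff.2 fun ψ => ?_
  have h1 := weaklyConverges_zero_iff.1 hr (translate (-z₀) ψ)
  simp only [inner_translate_right]
  exact tendsto_inner_zero_of_tendsto (((continuous_translate_left ψ).tendsto (-z₀)).comp hz.neg)
    hB h1

/-- `W` is a weak limit of translates of a subsequence of `v`. -/
def IsTranslatedLimit (v : ℕ → H1) (W : H1) : Prop :=
  ∃ (φ : ℕ → ℕ) (y : ℕ → Plane), StrictMono φ ∧
    WeaklyConverges (fun k => translate (y k) (v (φ k))) W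

theorem IsTranslatedLimit.of_comp {v : ℕ → H1} {W : H1} {φ : ℕ → ℕ} (hφ : StrictMono φ)
    (h : IsTranslatedLimit (fun k => v (φ k)) W) : IsTranslatedLimit v W := by
  obtain ⟨ψ, y, hψ, h⟩ := h
  exact ⟨fun k => φ (ψ k), y, hφ.comp hψ, h⟩

/-- Subtracting a weak limit creates no new weak limits. -/
theorem IsTranslatedLimit.of_sub {v : ℕ → H1} {B : ℝ} (hB : ∀ n, ‖v n‖ ≤ B) {φ : ℕ → ℕ}
    {y : ℕ → Plane} {V W : H1} (hφ : StrictMono φ)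
    (hV : WeaklyConverges (fun k => translate (y k) (v (φ k))) V)
    (hW : IsTranslatedLimit (fun k => translate (y k) (v (φ k)) - V) W) :
    W = 0 ∨ IsTranslatedLimit v W := by
  obtain ⟨ψ, z, hψ, h⟩ := hW
  -- If the shifts are bounded along a subsequence, they may be taken convergent; the remainder is
  -- weakly null, so W = 0. Otherwise they escape to infinity, the translates of `V` are weakly
  -- null, and adding them back exhibits W as a limit of `v` itself.
  by_cases hz : ∃ R, ∃ᶠ k in atTop, ‖z k‖ ≤ R
  · left
    obtain ⟨R, hR⟩ := hz
    obtain ⟨σ, hσ, hσR⟩ := extraction_of_frequently_atTop hR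
    obtain ⟨z₀, -, τ, hτ, hz₀⟩ := (isCompact_closedBall (0 : Plane) R).tendsto_subseq
      (x := fun k => z (σ k)) fun k => by simpa using hσR k
    have hr : WeaklyConverges (fun k => translate (y k) (v (φ k)) - V) 0 := by
      simpa only [sub_self] using hV.sub (weaklyConverges_const V)
    have h1 := (hr.comp (hψ.comp (hσ.comp hτ))).translate_zero (B := B + ‖V‖) (fun k => by
      refine (norm_sub_le _ _).trans ?_
      rw [norm_translate]
      gcongr
      exact hB _) hz₀
    exact (h.comp (hσ.comp hτ)).unique h1
  · right
    push Not at hz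
    have hz' : Tendsto (fun k => ‖z k‖) atTop atTop :=
      tendsto_atTop.2 fun R => (hz R).mono fun k hk => hk.le
    refine ⟨fun k => φ (ψ k), fun k => z k + y (ψ k), hφ.comp hψ, ?_⟩
    have h1 := h.add (weaklyConverges_translate_of_norm_atTop V hz')
    rw [add_zero] at h1
    have e : (fun k => translate (z k) (translate (y (ψ k)) (v (φ (ψ k))) - V) + translate (z k) V)
        = fun k => translate (z k + y (ψ k)) (v (φ (ψ k))) := by
      funext k
      rw [translate_sub, translate_translate, sub_add_cancel]
    rwa [e] at h1

/-- The asymptotics of the norms and of the quartic functional after subtraction of a weak limit. -/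
theorem WeaklyConverges.tendsto_sub {v : ℕ → H1} {B : ℝ} (hB : ∀ n, ‖v n‖ ≤ B) {φ : ℕ → ℕ}
    {y : ℕ → Plane} {V : H1} (hφ : StrictMono φ)
    (hV : WeaklyConverges (fun k => translate (y k) (v (φ k))) V) {ν γ s g q : ℝ}
    (hs : Tendsto (fun n => ‖toL2 (v n)‖ ^ 2) atTop (𝓝 s))
    (hg : Tendsto (fun n => ‖grad (v n)‖ ^ 2) atTop (𝓝 g))
    (hq : Tendsto (fun n => quartic ν γ (v n)) atTop (𝓝 q)) :
    Tendsto (fun k => ‖toL2 (translate (y k) (v (φ k)) - V)‖ ^ 2) atTop (𝓝 (s - ‖toL2 V‖ ^ 2)) ∧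
    Tendsto (fun k => ‖grad (translate (y k) (v (φ k)) - V)‖ ^ 2) atTop (𝓝 (g - ‖grad V‖ ^ 2)) ∧
    Tendsto (fun k => quartic ν γ (translate (y k) (v (φ k)) - V)) atTop
      (𝓝 (q - quartic ν γ V)) := by
  refine ⟨?_, ?_, ?_⟩
  · simp only [toL2_sub]
    refine tendsto_norm_sub_sq (hV.inner_toL2 _) ?_
    simpa only [norm_toL2_translate, Function.comp_def] using hs.comp hφ.tendsto_atTop
  · have e : ∀ u w : H1, grad (u - w) = grad u - grad w := fun u w => map_sub gradL u w
    simp only [e]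
    refine tendsto_norm_sub_sq (hV.inner_grad _) ?_
    simpa only [norm_grad_translate, Function.comp_def] using hg.comp hφ.tendsto_atTop
  · have h1 := hV.tendsto_quartic_sub (B := B) (fun k => by rw [norm_translate]; exact hB _) ν γ
    have h2 := (hq.comp hφ.tendsto_atTop).sub h1
    refine h2.congr fun k => ?_
    simp only [Function.comp_apply, quartic_translate]
    ring

/-! ### Exhausting the quartic functional by weak limits -/

theorem eventually_norm_le_of_tendsto {v : ℕ → H1} {s g B : ℝ} (hB0 : 0 ≤ B)
    (hs : Tendsto (fun n => ‖toL2 (v n)‖ ^ 2) atTop (𝓝 s))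
    (hg : Tendsto (fun n => ‖grad (v n)‖ ^ 2) atTop (𝓝 g)) (hB : s + g < B ^ 2) :
    ∀ᶠ n in atTop, ‖v n‖ ≤ B := by
  filter_upwards [(hs.add hg).eventually_lt_const hB] with n hn
  rw [← norm_sq_eq] at hn
  exact le_of_sq_le_sq hn.le hB0

/-- The upper bound for the quartic functional in terms of the weak limits, up to a small error. -/
theorem exists_quartic_limit_le {ν γ c A ε B : ℝ} (hc0 : 0 ≤ c) (hA : 0 ≤ A) (hε : 0 < ε)
    (hB0 : 0 ≤ B) (hc : ∀ u : H1, quartic ν γ u ≤ c * ‖grad u‖ ^ 2 * ‖toL2 u‖ ^ 2) :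
    ∃ δ, 0 < δ ∧ ∀ (N : ℕ) (v : ℕ → H1) (s g q : ℝ), (∃ R, ∀ n, ‖v n‖ ≤ R) →
      Tendsto (fun n => ‖toL2 (v n)‖ ^ 2) atTop (𝓝 s) →
      Tendsto (fun n => ‖grad (v n)‖ ^ 2) atTop (𝓝 g) →
      Tendsto (fun n => quartic ν γ (v n)) atTop (𝓝 q) → s + g < B ^ 2 → s < N * δ →
      (∀ W, IsTranslatedLimit v W → ‖toL2 W‖ ^ 2 ≤ A) → q ≤ c * A * g + ε := by
  -- This `δ` serves every remainder: `B` bounds only the limit s + g, which decreases under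
  -- removal, while the uniform bound `R` is allowed to grow.
  obtain ⟨δ, hδ, H⟩ := exists_translate_weaklyConverges ν γ (ε := ε) (B := B) hε
  refine ⟨δ, hδ, fun N => ?_⟩
  -- Each removal lowers the mass `s` by at least `δ`, so `N` limits the number of removals; for `N
  -- = 0` the condition s < 0 is absurd.
  induction N with
  | zero =>
    intro v s g q _ hs _ _ _ hN
    have : 0 ≤ s := ge_of_tendsto' hs fun n => by positivity
    simp only [CharP.cast_eq_zero, zero_mul] at hN
    linarith
  | succ N ih =>
    rintro v s g q ⟨R, hR⟩ hs hg hq hsg hN hW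
    have hg0 : 0 ≤ g := ge_of_tendsto' hg fun n => by positivity
    by_contra! hlt
    have hqε : ε < q := lt_of_le_of_lt (le_add_of_nonneg_left (by positivity)) hlt
    obtain ⟨φ, y, V, hφ, hV, hδV⟩ := H v <| by
      filter_upwards [eventually_norm_le_of_tendsto hB0 hs hg hsg,
        hq.eventually_const_lt hqε] with n h1 h2
      exact ⟨h1, h2.le⟩
    obtain ⟨hs', hg', hq'⟩ := hV.tendsto_sub hR hφ hs hg hq
    have hVA := hW V ⟨φ, y, hφ, hV⟩
    have h1 := ih _ _ _ _ ⟨R + ‖V‖, fun k => (norm_sub_le _ _).trans (by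
      rw [norm_translate]; gcongr; exact hR _)⟩ hs' hg' hq'
      (by nlinarith [sq_nonneg ‖toL2 V‖, sq_nonneg ‖grad V‖])
      (by push_cast at hN; linarith) fun W hW' => by
        rcases IsTranslatedLimit.of_sub hR hφ hV hW' with h0 | h0
        · rw [h0, toL2_zero, norm_zero]; simpa using hA
        · exact hW W h0
    -- Q(V) ≤ c A ‖∇V‖² restores exactly the gradient that the remainder lost.
    have h2 := hc V
    have h3 : c * ‖grad V‖ ^ 2 * ‖toL2 V‖ ^ 2 ≤ c * ‖grad V‖ ^ 2 * A := by gcongr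
    nlinarith

/-- The upper bound for the quartic functional in terms of the weak limits. -/
theorem quartic_limit_le {ν γ c A : ℝ} (hc0 : 0 ≤ c) (hA : 0 ≤ A)
    (hc : ∀ u : H1, quartic ν γ u ≤ c * ‖grad u‖ ^ 2 * ‖toL2 u‖ ^ 2) {v : ℕ → H1} {s g q R : ℝ}
    (hR : ∀ n, ‖v n‖ ≤ R) (hs : Tendsto (fun n => ‖toL2 (v n)‖ ^ 2) atTop (𝓝 s))
    (hg : Tendsto (fun n => ‖grad (v n)‖ ^ 2) atTop (𝓝 g))
    (hq : Tendsto (fun n => quartic ν γ (v n)) atTop (𝓝 q))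
    (hW : ∀ W, IsTranslatedLimit v W → ‖toL2 W‖ ^ 2 ≤ A) : q ≤ c * A * g := by
  refine le_of_forall_pos_le_add fun ε hε => ?_
  obtain ⟨δ, hδ, H⟩ := exists_quartic_limit_le (B := √(|s + g| + 1)) hc0 hA hε
    (Real.sqrt_nonneg _) hc
  obtain ⟨N, hN⟩ := exists_nat_gt (s / δ)
  refine H N v s g q ⟨R, hR⟩ hs hg hq ?_ ((div_lt_iff₀ hδ).1 hN) hW
  rw [Real.sq_sqrt (by positivity)]
  exact (le_abs_self _).trans_lt (lt_add_one _)

/-! ### The optimal constant -/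

/-- A vanishing gradient forces |u|² = 0 by Gagliardo–Nirenberg. This supplies the strict inequality
in the final contradiction. -/
theorem norm_grad_pos {u : H1} (hu : toL2 u ≠ 0) : 0 < ‖grad u‖ := by
  obtain ⟨C, hC, hGN⟩ := exists_norm_normSq_le
  refine (norm_nonneg _).lt_of_ne' fun h0 => hu ?_
  have h1 := hGN u
  rw [h0, mul_zero, zero_mul, norm_le_zero_iff] at h1
  apply Lp.ext
  have h2 := coeFn_normSq u
  rw [h1] at h2
  filter_upwards [h2, Lp.coeFn_zero ℂ 2 (volume : Measure Plane)] with x h3 h4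
  rw [h4] at h3 ⊢
  simpa using h3.symm

theorem exists_abs_quartic_le (ν γ : ℝ) :
    ∃ c, 0 ≤ c ∧ ∀ u : H1, |quartic ν γ u| ≤ c * ‖grad u‖ ^ 2 * ‖toL2 u‖ ^ 2 := by
  obtain ⟨C, hC, hGN⟩ := exists_norm_normSq_le
  refine ⟨‖opLCLM ν γ‖ * C ^ 2, by positivity, fun u => (abs_quartic_le ν γ u).trans ?_⟩
  calc _ ≤ ‖opLCLM ν γ‖ * (C * ‖grad u‖ * ‖toL2 u‖) ^ 2 := by
        gcongr; exact hGN u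
    _ = _ := by ring

theorem exists_mem_admissibleConstants (ν γ : ℝ) : ∃ c, c ∈ admissibleConstants ν γ := by
  obtain ⟨c, -, hc⟩ := exists_abs_quartic_le ν γ
  exact ⟨c, fun u => (le_abs_self _).trans (hc u)⟩

theorem pos_of_quartic_pos {ν γ : ℝ} {u : H1} (hu : 0 < quartic ν γ u) :
    0 < ‖grad u‖ ^ 2 * ‖toL2 u‖ ^ 2 := by
  obtain ⟨c, hc⟩ := exists_mem_admissibleConstants ν γ
  have h := hu.trans_le (hc u)
  rw [mul_assoc] at h
  exact (by positivity : 0 ≤ ‖grad u‖ ^ 2 * ‖toL2 u‖ ^ 2).lt_of_ne' fun h0 => by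
    rw [h0, mul_zero] at h; exact lt_irrefl _ h

theorem div_le_of_mem_admissibleConstants {ν γ C : ℝ} (hC : C ∈ admissibleConstants ν γ) {u : H1}
    (hu : 0 < ‖grad u‖ ^ 2 * ‖toL2 u‖ ^ 2) :
    quartic ν γ u / (‖grad u‖ ^ 2 * ‖toL2 u‖ ^ 2) ≤ C := by
  rw [div_le_iff₀ hu, ← mul_assoc]
  exact hC u

/-- The optimal constant is attained and positive if the quartic functional takes a positive
value. -/
theorem isLeast_Copt {ν γ : ℝ} {u : H1} (hu : 0 < quartic ν γ u) :
    IsLeast (admissibleConstants ν γ) (Copt ν γ) ∧ 0 < Copt ν γ := by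
  obtain ⟨c, hc⟩ := exists_mem_admissibleConstants ν γ
  have hp := pos_of_quartic_pos hu
  have hbdd : BddBelow (admissibleConstants ν γ) :=
    ⟨_, fun C hC => div_le_of_mem_admissibleConstants hC hp⟩
  refine ⟨⟨fun w => ?_, fun C hC => csInf_le hbdd hC⟩, (div_pos hu hp).trans_le
    (le_csInf ⟨c, hc⟩ fun C hC => div_le_of_mem_admissibleConstants hC hp)⟩
  -- If the product of norms vanishes, any admissible constant already gives Q(w) ≤ 0; otherwise the
  -- quotient is a lower bound for all admissible constants.
  rcases (by positivity : 0 ≤ ‖grad w‖ ^ 2 * ‖toL2 w‖ ^ 2).eq_or_lt' with h0 | h0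
  · have := hc w
    rw [mul_assoc, h0, mul_zero] at this
    rwa [mul_assoc, h0, mul_zero]
  · rw [mul_assoc, ← div_le_iff₀ h0]
    exact le_csInf ⟨c, hc⟩ fun C hC => div_le_of_mem_admissibleConstants hC h0

/-! ### Subsequences and conclusion -/

theorem exists_subseq_tendsto {ν γ B m M : ℝ} {v : ℕ → H1} (hB : ∀ n, ‖v n‖ ≤ B)
    (hgrad : limsup (fun n => ‖grad (v n)‖ ^ 2) atTop ≤ M ^ 2)
    (hquartic : m ^ 4 ≤ limsup (fun n => quartic ν γ (v n)) atTop) :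
    ∃ (φ : ℕ → ℕ) (s g q : ℝ), StrictMono φ ∧
      Tendsto (fun k => ‖toL2 (v (φ k))‖ ^ 2) atTop (𝓝 s) ∧
      Tendsto (fun k => ‖grad (v (φ k))‖ ^ 2) atTop (𝓝 g) ∧
      Tendsto (fun k => quartic ν γ (v (φ k))) atTop (𝓝 q) ∧ g ≤ M ^ 2 ∧ m ^ 4 ≤ q := by
  obtain ⟨c, hc0, hc⟩ := exists_abs_quartic_le ν γ
  have hB0 : 0 ≤ B := (norm_nonneg _).trans (hB 0)
  have hs : ∀ n, ‖toL2 (v n)‖ ^ 2 ≤ B ^ 2 := fun n =>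
    pow_le_pow_left₀ (norm_nonneg _) ((norm_toL2_le _).trans (hB n)) 2
  have hg : ∀ n, ‖grad (v n)‖ ^ 2 ≤ B ^ 2 := fun n =>
    pow_le_pow_left₀ (norm_nonneg _) ((norm_grad_le _).trans (hB n)) 2
  have hq' : ∀ n, |quartic ν γ (v n)| ≤ c * B ^ 2 * B ^ 2 := fun n => by
    refine (hc (v n)).trans ?_
    exact mul_le_mul (mul_le_mul_of_nonneg_left (hg n) hc0) (hs n) (by positivity) (by positivity)
  have hq : ∀ n, quartic ν γ (v n) ≤ c * B ^ 2 * B ^ 2 := fun n => (abs_le.1 (hq' n)).2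
  have hcob : IsCoboundedUnder (· ≤ ·) atTop fun n => quartic ν γ (v n) :=
    (isBoundedUnder_of ⟨_, fun n => (abs_le.1 (hq' n)).1⟩ :
      IsBoundedUnder (· ≥ ·) atTop fun n => quartic ν γ (v n)).isCoboundedUnder_le
  have hfreq : ∀ k : ℕ, ∃ᶠ n in atTop, m ^ 4 - 1 / ((k : ℝ) + 1) < quartic ν γ (v n) := fun k =>
    frequently_lt_of_lt_limsup hcob ((sub_lt_self _ (by positivity)).trans_le hquartic)
  obtain ⟨σ, hσ, hσq⟩ := extraction_forall_of_frequently hfreq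
  -- The lower corner `m ^ 4 - 1` comes from 1/(k+1) ≤ 1. Compactness of the box makes all three
  -- quantities converge along one subsequence.
  have hmem : ∀ k, (‖toL2 (v (σ k))‖ ^ 2, ‖grad (v (σ k))‖ ^ 2, quartic ν γ (v (σ k))) ∈
      Set.Icc ((0, 0, m ^ 4 - 1) : ℝ × ℝ × ℝ) (B ^ 2, B ^ 2, c * B ^ 2 * B ^ 2) := fun k => by
    refine ⟨⟨by positivity, by positivity, ?_⟩, hs _, hg _, hq _⟩
    refine le_trans ?_ (hσq k).le
    have : 1 / ((k : ℝ) + 1) ≤ 1 := by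
      rw [div_le_one (by positivity)]
      linarith [(Nat.cast_nonneg k : (0 : ℝ) ≤ k)]
    exact sub_le_sub_left this _
  obtain ⟨⟨s, g, q⟩, -, τ, hτ, hlim⟩ := isCompact_Icc.tendsto_subseq hmem
  have h1 := (continuous_fst.tendsto _).comp hlim
  have h2 := ((continuous_fst.comp continuous_snd).tendsto _).comp hlim
  have h3 := ((continuous_snd.comp continuous_snd).tendsto _).comp hlim
  refine ⟨fun k => σ (τ k), s, g, q, hσ.comp hτ, h1, h2, h3, ?_, ?_⟩
  · refine le_of_forall_pos_le_add fun ε hε => ?_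
    have h4 : ∀ᶠ n in atTop, ‖grad (v n)‖ ^ 2 < M ^ 2 + ε :=
      eventually_lt_of_limsup_lt (by linarith)
        (isBoundedUnder_of ⟨B ^ 2, hg⟩)
    exact le_of_tendsto h2 (((hσ.comp hτ).tendsto_atTop.eventually h4).mono fun k hk => hk.le)
  · have h5 : Tendsto (fun k => m ^ 4 - 1 / ((τ k : ℝ) + 1)) atTop (𝓝 (m ^ 4 - 0)) :=
      tendsto_const_nhds.sub (tendsto_one_div_add_atTop_nhds_zero_nat.comp hτ.tendsto_atTop)
    rw [sub_zero] at h5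
    exact le_of_tendsto_of_tendsto' h5 h3 fun k => (hσq (τ k)).le

/-- Applied to `v`, `quartic_limit_le` gives only a non-strict bound. One limit `V` with nonzero
gradient is therefore split off first: its contribution is strictly below c A ‖∇V‖², and the bound
is applied to the remainder. -/
theorem exists_isTranslatedLimit_le {ν γ B m M : ℝ} {v : ℕ → H1} (hB : ∀ n, ‖v n‖ ≤ B)
    (hm : 0 < m) (hM : 0 < M) (hC : IsLeast (admissibleConstants ν γ) (Copt ν γ))
    (hC0 : 0 < Copt ν γ) {s g q : ℝ} (hs : Tendsto (fun n => ‖toL2 (v n)‖ ^ 2) atTop (𝓝 s))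
    (hg : Tendsto (fun n => ‖grad (v n)‖ ^ 2) atTop (𝓝 g))
    (hq : Tendsto (fun n => quartic ν γ (v n)) atTop (𝓝 q)) (hgM : g ≤ M ^ 2) (hmq : m ^ 4 ≤ q) :
    ∃ V, IsTranslatedLimit v V ∧ m ^ 4 / (M ^ 2 * Copt ν γ) ≤ ‖toL2 V‖ ^ 2 := by
  set c := Copt ν γ with hc
  set A := m ^ 4 / (M ^ 2 * c) with hA
  have hA0 : 0 < A := by positivity
  by_contra! hcon
  have hq0 : 0 < q := (by positivity : 0 < m ^ 4).trans_le hmq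
  obtain ⟨δ, hδ, H⟩ := exists_translate_weaklyConverges ν γ (ε := q / 2) (B := B) (by positivity)
  obtain ⟨φ, y, V, hφ, hV, hδV⟩ := H v <| by
    filter_upwards [hq.eventually_const_lt (half_lt_self hq0)] with n hn
    exact ⟨hB n, hn.le⟩
  have hVA := hcon V ⟨φ, y, hφ, hV⟩
  have hV0 : 0 < ‖grad V‖ := norm_grad_pos fun h0 => by
    rw [h0, norm_zero] at hδV
    norm_num at hδV
    linarith
  obtain ⟨hs', hg', hq'⟩ := hV.tendsto_sub hB hφ hs hg hq
  have h1 := quartic_limit_le (R := B + ‖V‖) hC0.le hA0.le hC.1 (fun k => (norm_sub_le _ _).trans (by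
      rw [norm_translate]; gcongr; exact hB _)) hs' hg' hq' fun W hW => by
    rcases IsTranslatedLimit.of_sub hB hφ hV hW with h0 | h0
    · rw [h0, toL2_zero, norm_zero]; simpa using hA0.le
    · exact (hcon W h0).le
  have h2 : quartic ν γ V ≤ c * ‖grad V‖ ^ 2 * ‖toL2 V‖ ^ 2 := hC.1 V
  have h3 : c * ‖grad V‖ ^ 2 * ‖toL2 V‖ ^ 2 < c * ‖grad V‖ ^ 2 * A := by gcongr
  have h4 : c * A * g ≤ c * A * M ^ 2 := by gcongr
  have h5 : c * A * M ^ 2 = m ^ 4 := by rw [hA]; field_simp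
  nlinarith

end DaveyStewartson

end

theorem theorem5 (ν γ : ℝ) (hν : ν = 1 ∨ ν = -1) (hγ : 0 < γ)
    (v : ℕ → DaveyStewartson.H1) (hbdd : ∃ B : ℝ, ∀ n, ‖v n‖ ≤ B)
    (m M : ℝ) (hm : 0 < m) (hM : 0 < M)
    (hgrad : limsup (fun n => ‖DaveyStewartson.grad (v n)‖ ^ 2) atTop ≤ M ^ 2)
    (hquartic : m ^ 4 ≤ limsup (fun n => DaveyStewartson.quartic ν γ (v n)) atTop) :
    -- the optimal constant is attained as a minimum and is positive
    IsLeast (DaveyStewartson.admissibleConstants ν γ) (DaveyStewartson.Copt ν γ) ∧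
    0 < DaveyStewartson.Copt ν γ ∧
    ∃ (x : ℕ → DaveyStewartson.Plane) (φ : ℕ → ℕ) (V : DaveyStewartson.H1), StrictMono φ ∧
      DaveyStewartson.WeaklyConverges (fun k => DaveyStewartson.translate (x (φ k)) (v (φ k))) V ∧
      m ^ 2 / (M * √(DaveyStewartson.Copt ν γ)) ≤ ‖DaveyStewartson.toL2 V‖ := by
  obtain ⟨B, hB⟩ := hbdd
  obtain ⟨σ, s, g, q, hσ, hs, hg, hq, hgM, hmq⟩ :=
    DaveyStewartson.exists_subseq_tendsto hB hgrad hquartic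
  have hq0 : 0 < q := (by positivity : 0 < m ^ 4).trans_le hmq
  -- A single function with positive quartic functional is what bounds the admissible constants
  -- below by a positive number.
  obtain ⟨k, hk⟩ := (hq.eventually_const_lt hq0).exists
  obtain ⟨hC, hC0⟩ := DaveyStewartson.isLeast_Copt hk
  obtain ⟨V, hV, hVm⟩ := DaveyStewartson.exists_isTranslatedLimit_le (fun n => hB (σ n)) hm hM hC
    hC0 hs hg hq hgM hmq
  obtain ⟨φ, y, hφ, hV'⟩ := hV.of_comp hσ
  -- The shifts are known only along the subsequence; at the other indices they are set to 0.
  refine ⟨hC, hC0, Function.extend φ y 0, φ, V, hφ, ?_, ?_⟩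
  · simpa only [hφ.injective.extend_apply] using hV'
  · refine le_of_sq_le_sq ?_ (norm_nonneg _)
    have e : (m ^ 2 / (M * √(DaveyStewartson.Copt ν γ))) ^ 2
        = m ^ 4 / (M ^ 2 * DaveyStewartson.Copt ν γ) := by
      rw [div_pow, mul_pow, Real.sq_sqrt hC0.le]
      ring
    rwa [e]
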